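/- Let $\beta$ be an indeterminate, $n\ge 1$, and write $x\oplus y=x+y+\beta xy$, $x\ominus y=\dfrac{x-y}{1+\beta y}$, $\ominus t=\dfrac{-t}{1+\beta t}$. Let $\mathcal{SP}_n$ be the set of strict partitions $\lambda=(\lambda_1>\cdots>\lambda_r>0)$ of length $r\le n$ (including the empty one), and for $\lambda\in\mathcal{SP}_n$ let $$GQ_\lambda(x_1,\ldots,x_n)=\frac{1}{(n-r)!}\sum_{w\in S_n}w\left[\prod_{i=1}^r (x_i\oplus x_i)\,x_i^{\lambda_i-1}\;\prod_{i=1}^r\prod_{j=i+1}^n\frac{x_i\oplus x_j}{x_i\ominus x_j}\right],$$ where $w\in S_n$ acts by permuting the variables $x_1,\ldots,x_n$. Let $G\Gamma_n\subset\mathbb{Z}[\beta][x_1,\ldots,x_n]$ be the ring of symmetric polynomials $f$ such that for all $1\le i<j\le n$ the rational function $f(x_1,\ldots,x_{i-1},t,x_{i+1},\ldots,x_{j-1},\ominus t,x_{j+1},\ldots,x_n)$ does not depend on $t$, and let $G\Gamma_{n,+}$ be the subring of those $F\in G\Gamma_n$ for which $F(t,x_2,\ldots,x_n)-F(0,x_2,\ldots,x_n)$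 is divisible by $t\oplus t$ in $\mathbb{Z}[\beta][t,x_2,\ldots,x_n]$. Then the functions $GQ_\lambda(x_1,\ldots,x_n)$, $\lambda\in\mathcal{SP}_n$, are polynomials with coefficients in $\mathbb{Z}[\beta]$ and form a $\mathbb{Z}[\beta]$-basis of $G\Gamma_{n,+}$: $$G\Gamma_{n,+}=\bigoplus_{\lambda\in\mathcal{SP}_n}\mathbb{Z}[\beta]\,GQ_\lambda(x_1,\ldots,x_n).$$ -/

import Mathlib

open scoped Polynomial

noncomputable section

namespace KTheoreticQ

/-- The ring `ℤ[β]`; the formal parameter `β` is the polynomial variable. -/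
abbrev Coeff : Type := ℤ[X]

/-- The formal parameter `β`. -/
abbrev β : Coeff := Polynomial.X

/-- The polynomial ring `ℤ[β][x₁, …, xₙ]`; the variable `xᵢ` is indexed by `i - 1 : Fin n`. -/
abbrev PolyRing (n : ℕ) : Type := MvPolynomial (Fin n) Coeff

/-- The field of rational functions in `β, x₁, …, xₙ`. -/
abbrev RatField (n : ℕ) : Type := FractionRing (PolyRing n)

/-- `x ⊕ y = x + y + β x y`. -/
def oplus {R : Type*} [CommRing R] (b x y : R) : R := x + y + b * x * y

/-- `x ⊖ y = (x - y) / (1 + β y)`. -/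
def ominus {K : Type*} [Field K] (b x y : K) : K := (x - y) / (1 + b * y)

/-- The set of strict partitions of length at most `n`: strictly decreasing sequences
`λ₁ > ⋯ > λᵣ` of positive integers with `r ≤ n` (including the empty sequence). -/
structure StrictPartition (n : ℕ) where
  /-- The sequence `λ₁, …, λᵣ`. -/
  parts : List ℕ
  decreasing : parts.Pairwise (· > ·)
  pos : ∀ a ∈ parts, 0 < a
  length_parts_le : parts.length ≤ n

namespace StrictPartition

variable {n : ℕ}

/-- The length `r` of a strict partition. -/
def length (l : StrictPartition n) : ℕ := l.parts.length

theorem length_le (l : StrictPartition n) : l.length ≤ n := l.length_parts_le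

/-- The `i`-th part. -/
def part (l : StrictPartition n) (i : Fin l.length) : ℕ := l.parts.get i

end StrictPartition

/-- `[[x|b]]^k = (x ⊕ x)(x ⊕ b₁) ⋯ (x ⊕ b_{k-1})`, for `k ≥ 1`; here `b i` stands for `b_{i+1}`. -/
def dpow {R : Type*} [CommRing R] (bet : R) (b : ℕ → R) (x : R) (k : ℕ) : R :=
  oplus bet x x * ∏ i ∈ Finset.range (k - 1), oplus bet x (b i)

/-- The rational expression
`[[x|b]]^λ ∏_{i=1}^r ∏_{j=i+1}^n (x_i ⊕ x_j) / (x_i ⊖ x_j)` that is symmetrized in `GQ_λ`. -/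
def GQterm {K : Type*} [Field K] (bet : K) (b : ℕ → K) {n : ℕ} (l : StrictPartition n)
    (x : Fin n → K) : K :=
  (∏ i : Fin l.length, dpow bet b (x (Fin.castLE l.length_le i)) (l.part i)) *
    ∏ i : Fin l.length, ∏ j ∈ Finset.Ioi (Fin.castLE l.length_le i),
      oplus bet (x (Fin.castLE l.length_le i)) (x j) /
        ominus bet (x (Fin.castLE l.length_le i)) (x j)

/-- `GQ_λ(x₁, …, xₙ | b) = 1/(n-r)! ∑_{w ∈ Sₙ} w[⋯]`, evaluated at elements of a field. -/
def GQfactorial {K : Type*} [Field K] (bet : K) (b : ℕ → K) {n : ℕ} (l : StrictPartition n)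
    (x : Fin n → K) : K :=
  (1 / ((n - l.length).factorial : K)) *
    ∑ w : Equiv.Perm (Fin n), GQterm bet b l (fun i => x (w i))

/-- The `K`-theoretic `Q`-function `GQ_λ(x₁, …, xₙ)`, as an element of the field of rational
functions: the specialization `b₁ = b₂ = ⋯ = 0` of `GQ_λ(x₁, …, xₙ | b)`. -/
def GQ {n : ℕ} (l : StrictPartition n) : RatField n :=
  GQfactorial (algebraMap (PolyRing n) (RatField n) (MvPolynomial.C β)) (fun _ => 0) l
    (fun i => algebraMap (PolyRing n) (RatField n) (MvPolynomial.X i))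

/-- The embedding of `ℤ[β]` into the field `RatField n (t)` of rational functions in one further
variable `t`. (In particular `β` goes to the constant `β`, not to `t`.) -/
def coeffHom (n : ℕ) : Coeff →+* RatFunc (RatField n) :=
  (RatFunc.C : RatField n →+* RatFunc (RatField n)).comp
    ((algebraMap (PolyRing n) (RatField n)).comp MvPolynomial.C)

/-- The values substituted for the variables: `t` for `x_i`, `⊖t = -t / (1 + β t)` for `x_j`,
and `x_k` for `x_k` if `k ≠ i, j`. -/
def cancelPoint {n : ℕ} (i j : Fin n) (k : Fin n) : RatFunc (RatField n) :=
  if k = i then RatFunc.X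
  else if k = j then -RatFunc.X / (1 + coeffHom n β * RatFunc.X)
  else RatFunc.C (algebraMap (PolyRing n) (RatField n) (MvPolynomial.X k))

/-- The substitution
`f ↦ f(x₁, …, x_{i-1}, t, x_{i+1}, …, x_{j-1}, ⊖t, x_{j+1}, …, xₙ)`. -/
def cancelSubst {n : ℕ} (i j : Fin n) : PolyRing n →+* RatFunc (RatField n) :=
  MvPolynomial.eval₂Hom (coeffHom n) (cancelPoint i j)

/-- The ring `GΓ_n` of symmetric polynomials `f` such that, for all `i < j`, the rational function
`f(…, t, …, ⊖t, …)` does not depend on `t`. -/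
def GGamma (n : ℕ) : Subalgebra Coeff (PolyRing n) where
  carrier := {f | f.IsSymmetric ∧ ∀ i j : Fin n, i < j →
    cancelSubst i j f ∈ (RatFunc.C : RatField n →+* RatFunc (RatField n)).range}
  mul_mem' ha hb := ⟨ha.1.mul hb.1, fun i j h => by
    rw [map_mul]; exact mul_mem (ha.2 i j h) (hb.2 i j h)⟩
  add_mem' ha hb := ⟨ha.1.add hb.1, fun i j h => by
    rw [map_add]; exact add_mem (ha.2 i j h) (hb.2 i j h)⟩
  algebraMap_mem' r := ⟨MvPolynomial.IsSymmetric.C r, fun i j _ =>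
    ⟨algebraMap (PolyRing n) (RatField n) (MvPolynomial.C r), by
      simp [cancelSubst, coeffHom, MvPolynomial.algebraMap_eq]⟩⟩

/-- `F(x₁, x₂, …, xₙ) ↦ F(0, x₂, …, xₙ)`. -/
def zeroFirst (n : ℕ) [NeZero n] : PolyRing n →ₐ[Coeff] PolyRing n :=
  MvPolynomial.aeval (fun k => if k = 0 then 0 else MvPolynomial.X k)

/-- `x₁ ⊕ x₁`; the variable called `t` in `t ⊕ t` is `x₁` here. -/
def tt (n : ℕ) [NeZero n] : PolyRing n :=
  oplus (MvPolynomial.C β) (MvPolynomial.X 0) (MvPolynomial.X 0)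

/-- The subring `GΓ_{n,+}` of those `F ∈ GΓ_n` for which `F(t, x₂, …, xₙ) - F(0, x₂, …, xₙ)` is
divisible by `t ⊕ t` (in the polynomial ring `ℤ[β][t, x₂, …, xₙ]`, where `t` is written `x₁`). -/
def GGammaPlus (n : ℕ) [NeZero n] : Subalgebra Coeff (PolyRing n) where
  carrier := {F | F ∈ GGamma n ∧ tt n ∣ F - zeroFirst n F}
  mul_mem' {a b} ha hb := ⟨mul_mem ha.1 hb.1, by
    have h : a * b - zeroFirst n (a * b) =
        (a - zeroFirst n a) * b + zeroFirst n a * (b - zeroFirst n b) := by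
      rw [map_mul]; ring
    rw [h]
    exact dvd_add (ha.2.mul_right _) (hb.2.mul_left _)⟩
  add_mem' {a b} ha hb := ⟨add_mem ha.1 hb.1, by
    have h : a + b - zeroFirst n (a + b) =
        (a - zeroFirst n a) + (b - zeroFirst n b) := by
      rw [map_add]; ring
    rw [h]
    exact dvd_add ha.2 hb.2⟩
  algebraMap_mem' r := ⟨(GGamma n).algebraMap_mem r, by simp⟩

end KTheoreticQ

end

/-! The proof is an induction on the number of variables along the specialization x₁ = 0, carried
out in a module described purely by divisibility.

If x_i = t and x_j = ⊖t gives a value independent of t, that value is the one at t = 0, so x_i ⊕ x_j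
divides F - F|_{x_i = x_j = 0}; the condition on t ⊕ t is the same statement for i = j. Hence
`GGammaPlus` lies in `divisibilityModule`. This module also makes sense for n = 0 and is stable
under x₁ = 0. If F in it vanishes at x₁ = 0, then by symmetry every x_i ⊕ x_j with i ≤ j divides F.
These factors are pairwise coprime, so F = ∏_{i≤j}(x_i ⊕ x_j) · G with G symmetric. For λ of length
n, GQ_λ is up to sign this product times a Grothendieck polynomial, and Grothendieck polynomials
span the symmetric polynomials. So the kernel of the restriction is spanned by the GQ_λ of length n
(`mem_span_of_restrictVars_eq_zero`), while the shorter GQ_λ restrict to the GQ_λ in n - 1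
variables. Spanning and independence both follow.

Membership of GQ_λ rests on rewriting it as a sum over injections {1,…,r} → {1,…,n}, which absorbs
1/(n-r)!. When x_i ⊕ x_j = 0 with i ≠ j, the injections that hit i or j contribute zero, and in the
others the two factors cancel (`embSum_mem`). When x₁ ⊕ x₁ = 0, the variable x₁ drops out
(`embSum_cons`). Polynomiality comes from multiplying by the Vandermonde determinant, which divides
every alternating polynomial. -/

open scoped Polynomial

noncomputable section

namespace KTheoreticQ

open MvPolynomial Finset

/-! ### Separating one variable; divisibility by polynomials linear in it -/

section Separate

variable {σ R : Type*} [DecidableEq σ] [CommRing R]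

/-- Regard a polynomial as a univariate polynomial in the variable `X j`. -/
def sepVar (j : σ) : MvPolynomial σ R →ₐ[R] (MvPolynomial σ R)[X] :=
  aeval (Function.update (fun k => Polynomial.C (X k)) j Polynomial.X)

/-- The polynomial `f` does not involve the variable `X j`. -/
def FreeOf (j : σ) (f : MvPolynomial σ R) : Prop := sepVar j f = Polynomial.C f

@[simp] theorem sepVar_C (j : σ) (r : R) :
    sepVar j (C r : MvPolynomial σ R) = Polynomial.C (C r) := by
  simp only [sepVar, aeval_C]
  rfl

@[simp] theorem sepVar_X_self (j : σ) : sepVar j (X j : MvPolynomial σ R) = Polynomial.X := by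
  simp [sepVar]

theorem sepVar_X_of_ne {j k : σ} (h : k ≠ j) :
    sepVar j (X k : MvPolynomial σ R) = Polynomial.C (X k) := by
  simp [sepVar, h]

theorem FreeOf.const (j : σ) (r : R) : FreeOf j (C r : MvPolynomial σ R) := sepVar_C j r

theorem FreeOf.var {j k : σ} (h : k ≠ j) : FreeOf j (X k : MvPolynomial σ R) := sepVar_X_of_ne h

theorem FreeOf.one (j : σ) : FreeOf j (1 : MvPolynomial σ R) := by simp [FreeOf]

theorem FreeOf.add {j : σ} {f g : MvPolynomial σ R} (hf : FreeOf j f) (hg : FreeOf j g) :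
    FreeOf j (f + g) := by
  simp only [FreeOf, map_add] at *; rw [hf, hg]

theorem FreeOf.neg {j : σ} {f : MvPolynomial σ R} (hf : FreeOf j f) : FreeOf j (-f) := by
  simp only [FreeOf, map_neg] at *; rw [hf]

theorem FreeOf.mul {j : σ} {f g : MvPolynomial σ R} (hf : FreeOf j f) (hg : FreeOf j g) :
    FreeOf j (f * g) := by
  simp only [FreeOf, map_mul] at *; rw [hf, hg]

theorem FreeOf.pow {j : σ} {f : MvPolynomial σ R} (hf : FreeOf j f) (N : ℕ) :
    FreeOf j (f ^ N) := by
  simp only [FreeOf, map_pow] at *; rw [hf]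

theorem eval_sepVar (j : σ) (f : MvPolynomial σ R) : (sepVar j f).eval (X j) = f := by
  have : ((Polynomial.evalRingHom (X j : MvPolynomial σ R)).comp
      (sepVar j : MvPolynomial σ R →ₐ[R] _).toRingHom) = RingHom.id _ := by
    refine MvPolynomial.ringHom_ext (fun r => by simp) fun k => ?_
    by_cases h : k = j
    · subst h; simp
    · simp [sepVar_X_of_ne h]
  exact RingHom.congr_fun this f

/-- A ring homomorphism out of a polynomial ring is an evaluation of the polynomial in one
separated variable. -/
theorem map_eq_eval₂_sepVar {L : Type*} [CommRing L] (φ ψ : MvPolynomial σ R →+* L) (j : σ)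
    (hC : ∀ r, φ (C r) = ψ (C r)) (hX : ∀ k ≠ j, φ (X k) = ψ (X k)) (f : MvPolynomial σ R) :
    φ f = (sepVar j f).eval₂ ψ (φ (X j)) := by
  have : ((Polynomial.eval₂RingHom ψ (φ (X j))).comp
      (sepVar j : MvPolynomial σ R →ₐ[R] _).toRingHom) = φ := by
    refine MvPolynomial.ringHom_ext (fun r => by simp [hC]) fun k => ?_
    by_cases h : k = j
    · subst h; simp
    · simp [sepVar_X_of_ne h, hX k h]
  exact (RingHom.congr_fun this f).symm

theorem FreeOf.map_eq {L : Type*} [CommRing L] {φ ψ : MvPolynomial σ R →+* L} {j : σ}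
    (hC : ∀ r, φ (C r) = ψ (C r)) (hX : ∀ k ≠ j, φ (X k) = ψ (X k)) {f : MvPolynomial σ R}
    (hf : FreeOf j f) : φ f = ψ f := by
  rw [map_eq_eval₂_sepVar φ ψ j hC hX, hf, Polynomial.eval₂_C]

/-- Over a domain, the degree in `X j` of a divisor is at most that of a nonzero multiple. -/
theorem FreeOf.of_dvd [IsDomain R] {j : σ} {d p : MvPolynomial σ R} (hp : FreeOf j p)
    (h0 : p ≠ 0) (h : d ∣ p) : FreeOf j d := by
  have h1 : sepVar j d ∣ Polynomial.C p := by rw [← hp]; exact map_dvd _ h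
  have h2 : (sepVar j d).natDegree = 0 := by
    have := Polynomial.natDegree_le_of_dvd h1 (by simpa using h0)
    simpa using this
  obtain ⟨c, hc⟩ := Polynomial.natDegree_eq_zero.1 h2
  have h3 := eval_sepVar j d
  rw [← hc, Polynomial.eval_C] at h3
  rw [FreeOf, ← hc, h3]

/-- A divisor without the variable `X j` divides all coefficients. -/
theorem FreeOf.dvd_coeff {j : σ} {d p : MvPolynomial σ R} (hd : FreeOf j d) (h : d ∣ p) (k : ℕ) :
    d ∣ (sepVar j p).coeff k := by
  have h1 : Polynomial.C d ∣ sepVar j p := by rw [← hd]; exact map_dvd _ h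
  exact (Polynomial.C_dvd_iff_dvd_coeff _ _).1 h1 k

/-- Pseudo-division by a polynomial that is linear in `X j`. -/
theorem exists_pow_mul_sub {j : σ} {u v : MvPolynomial σ R} (hu : FreeOf j u) (hv : FreeOf j v)
    (f : MvPolynomial σ R) : ∃ N g, FreeOf j g ∧ v + u * X j ∣ u ^ N * f - g := by
  induction f using MvPolynomial.induction_on with
  | C a => exact ⟨0, C a, FreeOf.const j a, by simp⟩
  | add f₁ f₂ h₁ h₂ =>
    obtain ⟨N₁, g₁, hg₁, k₁, e₁⟩ := h₁
    obtain ⟨N₂, g₂, hg₂, k₂, e₂⟩ := h₂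
    refine ⟨N₁ + N₂, u ^ N₂ * g₁ + u ^ N₁ * g₂,
      ((hu.pow _).mul hg₁).add ((hu.pow _).mul hg₂), u ^ N₂ * k₁ + u ^ N₁ * k₂, ?_⟩
    rw [pow_add]
    linear_combination u ^ N₂ * e₁ + u ^ N₁ * e₂
  | mul_X f k h =>
    obtain ⟨N, g, hg, q, e⟩ := h
    by_cases hk : k = j
    · subst hk
      refine ⟨N + 1, -(v * g), (hv.mul hg).neg, u * X k * q + g, ?_⟩
      rw [pow_succ]
      linear_combination u * X k * e
    · refine ⟨N, g * X k, hg.mul (FreeOf.var hk), X k * q, ?_⟩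
      linear_combination X k * e

/-- A factor theorem for v + u·X_j with non-monic u. The pseudo-remainder g is killed by `φ`, hence
zero, so the linear form divides u^N f. It is coprime to u, since a common divisor would also divide
v, and u^N can be cancelled. -/
theorem dvd_of_root [IsDomain R] [UniqueFactorizationMonoid R] {L : Type*} [CommRing L]
    {j : σ} {u v : MvPolynomial σ R} (hu : FreeOf j u) (hv : FreeOf j v)
    (huv : IsRelPrime v u) (φ : MvPolynomial σ R →+* L) (hroot : φ (v + u * X j) = 0)
    (hinj : ∀ g, FreeOf j g → φ g = 0 → g = 0) {f : MvPolynomial σ R} (hf : φ f = 0) :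
    v + u * X j ∣ f := by
  obtain ⟨N, g, hg, q, e⟩ := exists_pow_mul_sub hu hv f
  have h0 : g = 0 := by
    refine hinj g hg ?_
    have h1 := congrArg φ e
    rw [map_sub, map_mul, map_mul, hroot, hf] at h1
    simpa using h1
  rw [h0, sub_zero] at e
  have h2 : IsRelPrime (v + u * X j) u := by
    intro d hd hd'
    exact huv ((dvd_add_left (hd'.mul_right _)).1 hd) hd'
  have h3 : IsRelPrime (v + u * X j) (u ^ N) := by
    have := IsRelPrime.prod_right (t := Finset.range N) (s := fun _ => u) (x := v + u * X j)
      (fun _ _ => h2)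
    simpa using this
  exact h3.dvd_of_dvd_mul_left ⟨q, e⟩

end Separate

/-! ### Coprimality of the factors x_i ⊕ x_j and of the differences x_j - x_i -/

section Pairs

variable {n : ℕ}

/-- The polynomial `xᵢ ⊕ xⱼ`. -/
def pairSum (i j : Fin n) : PolyRing n := oplus (C β) (X i) (X j)

theorem pairSum_comm (i j : Fin n) : pairSum i j = pairSum j i := by
  simp only [pairSum, oplus]; ring

theorem pairSum_eq (i j : Fin n) : pairSum i j = X i + (1 + C β * X i) * X j := by
  simp only [pairSum, oplus]; ring

theorem freeOf_pairSum {i j k : Fin n} (hi : i ≠ k) (hj : j ≠ k) : FreeOf k (pairSum i j) :=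
  ((FreeOf.var hi).add (FreeOf.var hj)).add (((FreeOf.const k β).mul (FreeOf.var hi)).mul
    (FreeOf.var hj))

/-- Since 2 is not invertible, this is what makes 2 + βt primitive as a polynomial in t; it is
needed for t ⊕ t = t(2 + βt). -/
theorem isRelPrime_two_beta : IsRelPrime (C 2 : PolyRing n) (C β) := by
  have hp : Prime (C β : PolyRing n) := (prime_C_iff _).2 Polynomial.prime_X
  refine fun d hd hd' => ?_
  obtain ⟨q, hq⟩ := hd'
  rcases hp.irreducible.isUnit_or_isUnit hq with h | h
  · exact h
  · exfalso
    have h1 : (C β : PolyRing n) ∣ C 2 := by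
      rw [hq]; exact (h.mul_right_dvd).2 hd
    rw [C_dvd_iff_dvd_coeff] at h1
    have h2 := h1 0
    rw [coeff_zero_C, Polynomial.X_dvd_iff] at h2
    norm_num at h2

theorem isRelPrime_X_one_add (i : Fin n) :
    IsRelPrime (X i : PolyRing n) (1 + C β * X i) := by
  intro d h h'
  exact isUnit_of_dvd_one ((dvd_add_left (h.mul_left _)).1 h')

/-- Such a divisor divides every coefficient with respect to `X j`: these include 2 and β if i = j,
and x_i and 1 + βx_i otherwise. Both pairs are coprime. -/
theorem isUnit_of_dvd_pairSum {i j : Fin n} {d : PolyRing n} (hd : FreeOf j d)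
    (h : d ∣ pairSum i j) : IsUnit d := by
  by_cases hij : i = j
  · subst hij
    have e : sepVar i (pairSum i i) = Polynomial.C (C 2) * Polynomial.X +
        Polynomial.C (C β) * Polynomial.X ^ 2 := by
      simp only [pairSum, oplus, map_add, map_mul, sepVar_X_self, sepVar_C]
      rw [show (C 2 : PolyRing n) = 1 + 1 by rw [one_add_one_eq_two]; rfl]
      simp only [map_add, map_one]; ring
    have h1 := hd.dvd_coeff h 1
    have h2 := hd.dvd_coeff h 2
    rw [e] at h1 h2
    simp at h1 h2
    exact isRelPrime_two_beta h1 h2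
  · have e : sepVar j (pairSum i j) = Polynomial.C (X i) +
        Polynomial.C (1 + C β * X i) * Polynomial.X := by
      simp only [pairSum_eq, map_add, map_mul, sepVar_X_self, sepVar_C, map_one,
        sepVar_X_of_ne hij]
    have h1 := hd.dvd_coeff h 0
    have h2 := hd.dvd_coeff h 1
    rw [e] at h1 h2
    simp only [Polynomial.coeff_add, Polynomial.coeff_C_mul, Polynomial.coeff_X_zero,
      Polynomial.coeff_X_one, Polynomial.coeff_C_zero, mul_zero, add_zero, mul_one,
      Polynomial.coeff_C_succ, zero_add] at h1 h2
    exact isRelPrime_X_one_add i h1 h2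

theorem pairSum_ne_zero (i j : Fin n) : pairSum i j ≠ 0 := by
  intro h
  have h1 := congrArg (fun p => (eval (fun _ => (1 : Coeff)) p).eval 0) h
  simp [pairSum, oplus] at h1

/-- Of two different unordered pairs, one has an index that the other lacks. A common divisor is
free of that variable, hence a unit. -/
theorem isRelPrime_pairSum {i j k l : Fin n} (h : s(i, j) ≠ s(k, l)) :
    IsRelPrime (pairSum i j) (pairSum k l) := by
  intro d h1 h2
  by_cases hj : j ≠ k ∧ j ≠ l
  · exact isUnit_of_dvd_pairSum
      ((freeOf_pairSum hj.1.symm hj.2.symm).of_dvd (pairSum_ne_zero k l) h2) h1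
  by_cases hi : i ≠ k ∧ i ≠ l
  · rw [pairSum_comm] at h1
    exact isUnit_of_dvd_pairSum
      ((freeOf_pairSum hi.1.symm hi.2.symm).of_dvd (pairSum_ne_zero k l) h2) h1
  by_cases hl : l ≠ i ∧ l ≠ j
  · exact isUnit_of_dvd_pairSum
      ((freeOf_pairSum hl.1.symm hl.2.symm).of_dvd (pairSum_ne_zero i j) h1) h2
  by_cases hk : k ≠ i ∧ k ≠ j
  · rw [pairSum_comm] at h2
    exact isUnit_of_dvd_pairSum
      ((freeOf_pairSum hk.1.symm hk.2.symm).of_dvd (pairSum_ne_zero i j) h1) h2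
  exfalso
  apply h
  rw [Sym2.eq_iff]
  grind

theorem isRelPrime_X_sub_X {i j k l : Fin n} (hij : i < j) (hkl : k < l)
    (h : (i, j) ≠ (k, l)) : IsRelPrime (X j - X i : PolyRing n) (X l - X k) := by
  have key : ∀ {a b : Fin n} {d : PolyRing n}, a ≠ b → FreeOf b d → d ∣ X a - X b →
      IsUnit d := by
    intro a b d hab hd h
    have h1 := hd.dvd_coeff h 1
    simp [sepVar_X_of_ne hab, Polynomial.coeff_X] at h1
    exact isUnit_of_dvd_one h1
  have free : ∀ {a b c : Fin n} {d : PolyRing n}, a ≠ b → a ≠ c → b ≠ c → d ∣ X a - X b →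
      FreeOf c d := by
    intro a b c d hab hac hbc h
    refine FreeOf.of_dvd (p := X a - X b) ?_ ?_ h
    · rw [sub_eq_add_neg]; exact (FreeOf.var hac).add (FreeOf.var hbc).neg
    · rw [sub_ne_zero]; exact fun h => hab (X_injective h)
  intro d h1 h2
  by_cases hj : j = l
  · subst hj
    have hik : i ≠ k := fun h' => h (by rw [h'])
    exact key hij.ne' (free hkl.ne' hij.ne' hik.symm h2) h1
  · by_cases hjk : j = k
    · subst hjk
      exact key hij.ne' (free hkl.ne' (hij.trans hkl).ne' hij.ne' h2) h1
    · rw [dvd_sub_comm] at h1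
      exact key hij.ne (free hkl.ne' (Ne.symm hj) (Ne.symm hjk) h2) h1

end Pairs

/-! ### Grothendieck alternants as a basis of the alternating polynomials -/

section Alternants

variable {n : ℕ}

/-- `∑_w sgn(w) w[f]`. -/
def antisymmetrize (f : PolyRing n) : PolyRing n :=
  ∑ w : Equiv.Perm (Fin n), (Equiv.Perm.sign w : ℤ) • rename w f

/-- Polynomials `P` with `w[P] = sgn(w) P`. -/
def IsAlternating (P : PolyRing n) : Prop :=
  ∀ w : Equiv.Perm (Fin n), rename w P = (Equiv.Perm.sign w : ℤ) • P

/-- The permuted exponent `m ∘ w`. -/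
def permExp (w : Equiv.Perm (Fin n)) (m : Fin n →₀ ℕ) : Fin n →₀ ℕ :=
  Finsupp.equivMapDomain w.symm m

@[simp] theorem permExp_apply (w : Equiv.Perm (Fin n)) (m : Fin n →₀ ℕ) (i : Fin n) :
    permExp w m i = m (w i) := by simp [permExp]

theorem degree_permExp (w : Equiv.Perm (Fin n)) (m : Fin n →₀ ℕ) :
    (permExp w m).degree = m.degree := by
  simp only [Finsupp.degree_eq_sum, permExp_apply]
  exact Equiv.sum_comp w m

theorem coeff_rename_perm (w : Equiv.Perm (Fin n)) (m : Fin n →₀ ℕ) (P : PolyRing n) :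
    coeff m (rename w P) = coeff (permExp w m) P := by
  have h : (permExp w m).mapDomain w = m := by
    rw [← Finsupp.equivMapDomain_eq_mapDomain]
    ext i; simp [permExp]
  conv_lhs => rw [← h]
  exact coeff_rename_mapDomain _ w.injective _ _

theorem coeff_antisymmetrize (m : Fin n →₀ ℕ) (f : PolyRing n) :
    coeff m (antisymmetrize f) =
      ∑ w : Equiv.Perm (Fin n), (Equiv.Perm.sign w : ℤ) • coeff (permExp w m) f := by
  simp only [antisymmetrize, coeff_sum, ← coeff_rename_perm]
  refine sum_congr rfl fun w _ => ?_
  exact map_zsmul (coeffAddMonoidHom m : PolyRing n →+ Coeff) _ _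

theorem IsAlternating.antisymmetrize (f : PolyRing n) : IsAlternating (antisymmetrize f) := by
  intro v
  simp only [KTheoreticQ.antisymmetrize, map_sum, map_zsmul, smul_sum]
  rw [← Equiv.sum_comp (Equiv.mulLeft v⁻¹)]
  refine sum_congr rfl fun w _ => ?_
  rw [rename_rename, smul_smul]
  congr 1
  · simp
  · congr 1; ext i; simp

theorem IsAlternating.sub {P Q : PolyRing n} (hP : IsAlternating P) (hQ : IsAlternating Q) :
    IsAlternating (P - Q) := fun w => by rw [map_sub, hP w, hQ w, smul_sub]

theorem IsAlternating.smul {P : PolyRing n} (hP : IsAlternating P) (c : Coeff) :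
    IsAlternating (c • P) := fun w => by rw [map_smul, hP w, smul_comm]

theorem IsAlternating.sum {ι : Type*} (s : Finset ι) {P : ι → PolyRing n}
    (hP : ∀ i ∈ s, IsAlternating (P i)) : IsAlternating (∑ i ∈ s, P i) := fun w => by
  rw [map_sum, smul_sum]; exact sum_congr rfl fun i hi => hP i hi w

theorem IsAlternating.coeff_permExp {P : PolyRing n} (hP : IsAlternating P)
    (w : Equiv.Perm (Fin n)) (m : Fin n →₀ ℕ) :
    coeff (permExp w m) P = (Equiv.Perm.sign w : ℤ) • coeff m P := by
  rw [← coeff_rename_perm, hP w]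
  exact map_zsmul (coeffAddMonoidHom m : PolyRing n →+ Coeff) _ _

theorem IsAlternating.coeff_eq_zero {P : PolyRing n} (hP : IsAlternating P) {m : Fin n →₀ ℕ}
    (hm : ¬ Function.Injective m) : coeff m P = 0 := by
  simp only [Function.Injective, not_forall] at hm
  obtain ⟨i, j, hij, hne⟩ := hm
  have h := hP.coeff_permExp (Equiv.swap i j) m
  have h1 : permExp (Equiv.swap i j) m = m := by
    ext k
    rw [permExp_apply]
    by_cases hi : k = i
    · subst hi; simp [hij]
    by_cases hj : k = j
    · subst hj; simp [hij]
    rw [Equiv.swap_apply_of_ne_of_ne hi hj]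
  rw [h1, Equiv.Perm.sign_swap hne] at h
  simp at h
  exact self_eq_neg.1 h

theorem exists_permExp_strictAnti {m : Fin n →₀ ℕ} (hm : Function.Injective m) :
    ∃ w, StrictAnti (permExp w m) := by
  refine ⟨Tuple.sort (OrderDual.toDual ∘ m), ?_⟩
  have h := Tuple.monotone_sort (OrderDual.toDual ∘ m)
  have h1 : Antitone (permExp (Tuple.sort (OrderDual.toDual ∘ m)) m) := by
    intro a b hab
    have := h hab
    simpa using this
  refine h1.strictAnti_of_injective fun a b hab => ?_
  exact (Tuple.sort _).injective (hm (by simpa using hab))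

/-- The polynomial `x^ν ∏ᵢ (1 + β xᵢ)^{i-1}`. -/
def grothMonomial (ν : Fin n →₀ ℕ) : PolyRing n :=
  monomial ν 1 * ∏ i : Fin n, (1 + C β * X i) ^ (i : ℕ)

/-- The numerator `det(x_j^{ν_i} (1 + β x_j)^{i-1})` of a Grothendieck polynomial. -/
def grothAlternant (ν : Fin n →₀ ℕ) : PolyRing n := antisymmetrize (grothMonomial ν)

theorem degreeOf_one_add_le (i k : Fin n) :
    degreeOf i (1 + C β * X k : PolyRing n) ≤ if i = k then 1 else 0 := by
  refine (degreeOf_add_le _ _ _).trans ?_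
  rw [degreeOf_one]
  refine max_le (Nat.zero_le _) ((degreeOf_C_mul_le _ _ _).trans ?_)
  rw [degreeOf_X]

theorem degreeOf_grothMonomial_le (ν : Fin n →₀ ℕ) (i : Fin n) :
    degreeOf i (grothMonomial ν) ≤ ν i + i := by
  refine (degreeOf_mul_le _ _ _).trans (add_le_add ?_ ?_)
  · rw [degreeOf_le_iff]
    intro m hm
    rw [Finset.mem_singleton.1 (support_monomial_subset hm)]
  · refine (degreeOf_prod_le _ _ _).trans ?_
    calc ∑ k : Fin n, degreeOf i ((1 + C β * X k : PolyRing n) ^ (k : ℕ))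
        ≤ ∑ k : Fin n, (if i = k then (k : ℕ) else 0) := by
          refine sum_le_sum fun k _ => (degreeOf_pow_le _ _ _).trans ?_
          refine (Nat.mul_le_mul_left _ (degreeOf_one_add_le i k)).trans ?_
          split_ifs <;> simp
      _ = i := by simp

/-- The factor ∏(1 + βx_i)^{i-1} has constant term 1, so every monomial other than x^ν has strictly
larger degree. -/
theorem coeff_grothMonomial (ν m : Fin n →₀ ℕ) (h : m.degree ≤ ν.degree) :
    coeff m (grothMonomial ν) = if m = ν then 1 else 0 := by
  rw [grothMonomial, coeff_monomial_mul']
  by_cases hm : m = ν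
  · subst hm
    rw [if_pos le_rfl, if_pos rfl, tsub_self, one_mul, ← constantCoeff_eq, map_prod]
    simp
  · rw [if_neg hm, if_neg]
    intro hle
    obtain ⟨k, rfl⟩ := exists_add_of_le hle
    rw [map_add] at h
    have : k.degree = 0 := by omega
    rw [Finsupp.degree_eq_zero_iff] at this
    exact hm (by rw [this, add_zero])

theorem eq_one_of_strictMono {w : Equiv.Perm (Fin n)} (h : StrictMono w) : w = 1 := by
  have := Subsingleton.elim (StrictMono.orderIsoOfSurjective w h w.surjective)
    (OrderIso.refl (Fin n))
  ext i
  have h1 := congrArg (fun e : Fin n ≃o Fin n => e i) this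
  simpa using congrArg Fin.val h1

/-- Unitriangularity with respect to the degree: a permutation carrying one strictly decreasing
exponent to another is the identity, so only w = 1 can contribute. -/
theorem coeff_grothAlternant {ν m : Fin n →₀ ℕ} (hν : StrictAnti ν) (hm : StrictAnti m)
    (h : m.degree ≤ ν.degree) : coeff m (grothAlternant ν) = if m = ν then 1 else 0 := by
  rw [grothAlternant, coeff_antisymmetrize, sum_eq_single 1]
  · rw [coeff_grothMonomial _ _ (by rwa [degree_permExp])]
    have : permExp 1 m = m := by ext i; simp
    simp [this]
  · intro w _ hw
    rw [coeff_grothMonomial _ _ (by rwa [degree_permExp]), if_neg, smul_zero]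
    intro he
    refine hw (eq_one_of_strictMono fun a b hab => ?_)
    have h1 := hν hab
    rw [← he] at h1
    simpa using hm.lt_iff_gt.1 h1
  · simp

theorem degreeOf_antisymmetrize_le {f : PolyRing n} {M : ℕ} (h : ∀ i, degreeOf i f ≤ M)
    (i : Fin n) : degreeOf i (antisymmetrize f) ≤ M := by
  refine (degreeOf_sum_le _ _ _).trans (Finset.sup_le fun w _ => ?_)
  have h1 : degreeOf i (rename w f) ≤ M := by
    have := degreeOf_rename_of_injective (p := f) w.injective (w.symm i)
    rw [Equiv.apply_symm_apply] at this
    rw [this]; exact h _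
  rw [zsmul_eq_mul]
  refine (degreeOf_mul_le _ _ _).trans ?_
  have h2 : degreeOf i (((Equiv.Perm.sign w : ℤ) : PolyRing n)) = 0 := by
    rw [← map_intCast (C : Coeff →+* PolyRing n), degreeOf_C]
  omega

/-- The extra factor (1 + βx_i)^{i-1} adds at most i - 1 to the degree, and a strictly decreasing
exponent has already dropped by that much. Subtracting alternants therefore never leaves the box of
degrees ≤ M. -/
theorem StrictAnti.apply_add_le {ν : Fin n →₀ ℕ} (hν : StrictAnti ν) {M : ℕ}
    (hM : ∀ i, ν i ≤ M) (i : Fin n) : ν i + i ≤ M := by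
  obtain ⟨k, hk⟩ := i
  induction k with
  | zero => simpa using hM _
  | succ k ih =>
    have h1 := ih (by omega)
    have h2 : ν ⟨k + 1, hk⟩ < ν ⟨k, by omega⟩ := hν (by simp)
    simp only at h1 ⊢
    omega

/-- Elimination from the lowest degree upwards. The correction terms have higher degree, so
termination is not automatic; it follows from the bound M on the degree in each variable, which
bounds the total degree by n·M. The number d measures the distance of the lowest degree from n·M +
1. -/
theorem IsAlternating.mem_span_of_degree {M : ℕ} (d : ℕ) (P : PolyRing n) (hP : IsAlternating P)
    (hM : ∀ i, degreeOf i P ≤ M) (hd : ∀ m, coeff m P ≠ 0 → n * M + 1 ≤ m.degree + d) :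
    P ∈ Submodule.span Coeff (grothAlternant '' {ν : Fin n →₀ ℕ | StrictAnti ν}) := by
  induction d generalizing P with
  | zero =>
    have : P = 0 := by
      ext1 m
      rw [coeff_zero]
      by_contra h
      have h1 := hd m h
      have h2 : m.degree ≤ n * M := by
        rw [Finsupp.degree_eq_sum]
        refine (sum_le_card_nsmul _ _ M fun i _ => ?_).trans (by simp)
        exact (degreeOf_le_iff.1 (hM i)) m (mem_support_iff.2 h)
      omega
    rw [this]; exact zero_mem _
  | succ d ih =>
    classical
    -- These are the strictly decreasing exponents in the lowest degree still allowed, n·M - d;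
    -- alternation determines all other coefficients of that degree.
    set s := P.support.filter (fun ν : Fin n →₀ ℕ => StrictAnti ν ∧ ν.degree + d = n * M) with hs
    have hmem : ∀ ν ∈ s, StrictAnti ν ∧ ν.degree + d = n * M ∧ ν ∈ P.support := fun ν h => by
      rw [hs, mem_filter] at h; exact ⟨h.2.1, h.2.2, h.1⟩
    have hQ : ∑ ν ∈ s, coeff ν P • grothAlternant ν ∈
        Submodule.span Coeff (grothAlternant '' {ν : Fin n →₀ ℕ | StrictAnti ν}) :=
      Submodule.sum_mem _ fun ν h => Submodule.smul_mem _ _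
        (Submodule.subset_span ⟨ν, (hmem ν h).1, rfl⟩)
    have hQa : IsAlternating (P - ∑ ν ∈ s, coeff ν P • grothAlternant ν) :=
      hP.sub (IsAlternating.sum _ fun ν _ => (IsAlternating.antisymmetrize _).smul _)
    suffices h : P - ∑ ν ∈ s, coeff ν P • grothAlternant ν ∈
        Submodule.span Coeff (grothAlternant '' {ν : Fin n →₀ ℕ | StrictAnti ν}) by
      simpa using add_mem h hQ
    refine ih _ hQa (fun i => ?_) fun m hm => ?_
    · refine (degreeOf_sub_le _ _ _).trans (max_le (hM i) ?_)
      refine (degreeOf_sum_le _ _ _).trans (Finset.sup_le fun ν h => ?_)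
      rw [smul_eq_C_mul]
      refine (degreeOf_C_mul_le _ _ _).trans (degreeOf_antisymmetrize_le (fun k => ?_) i)
      refine (degreeOf_grothMonomial_le ν k).trans
        (StrictAnti.apply_add_le (hmem ν h).1 (fun l => ?_) k)
      exact (degreeOf_le_iff.1 (hM l)) ν (hmem ν h).2.2
    · by_contra hlt
      have hinj : Function.Injective m := by
        by_contra h; exact hm (hQa.coeff_eq_zero h)
      obtain ⟨w, hw⟩ := exists_permExp_strictAnti hinj
      have hm' : coeff (permExp w m) (P - ∑ ν ∈ s, coeff ν P • grothAlternant ν) ≠ 0 := by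
        rw [hQa.coeff_permExp]
        exact smul_ne_zero (Int.cast_ne_zero.2 (Units.ne_zero _)) hm
      apply hm'
      rw [← degree_permExp w m] at hlt
      generalize permExp w m = μ at hw hlt
      rw [coeff_sub, coeff_sum, sub_eq_zero]
      have h1 : ∀ ν ∈ s, coeff μ (coeff ν P • grothAlternant ν) =
          if μ = ν then coeff ν P else 0 := fun ν h => by
        have := hmem ν h
        rw [coeff_smul, coeff_grothAlternant this.1 hw (by omega)]
        simp
      rw [sum_congr rfl h1, Finset.sum_ite_eq]
      split_ifs with h2
      · rfl
      · by_contra h3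
        refine h2 ?_
        rw [hs, mem_filter]
        have := hd μ h3
        exact ⟨mem_support_iff.2 h3, hw, by omega⟩

theorem IsAlternating.mem_span {P : PolyRing n} (hP : IsAlternating P) :
    P ∈ Submodule.span Coeff (grothAlternant '' {ν : Fin n →₀ ℕ | StrictAnti ν}) :=
  hP.mem_span_of_degree (M := P.totalDegree) (n * P.totalDegree + 1) P
    (fun i => degreeOf_le_totalDegree _ _) fun _ _ => by omega

/-- In a relation, an exponent of least degree with nonzero coefficient occurs in no other alternant
of the relation. -/
theorem linearIndependent_grothAlternant :
    LinearIndependent Coeff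
      (fun ν : {ν : Fin n →₀ ℕ // StrictAnti ν} => grothAlternant ν.1) := by
  rw [linearIndependent_iff']
  intro s g h
  by_contra! hne
  obtain ⟨i, hi, hgi⟩ := hne
  have hs : (s.filter (fun ν => g ν ≠ 0)).Nonempty := ⟨i, by simp [hi, hgi]⟩
  obtain ⟨ν, hν, hmin⟩ := exists_min_image _ (fun ν => ν.1.degree) hs
  rw [mem_filter] at hν
  have h1 := congrArg (coeff ν.1) h
  rw [coeff_sum, coeff_zero, sum_eq_single ν] at h1
  · rw [coeff_smul, coeff_grothAlternant ν.2 ν.2 le_rfl] at h1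
    simp at h1
    exact hν.2 h1
  · intro μ hμ hne
    by_cases h0 : g μ = 0
    · simp [h0]
    · rw [coeff_smul, coeff_grothAlternant μ.2 ν.2 (hmin μ (by simp [hμ, h0])), if_neg, smul_zero]
      exact fun h => hne (Subtype.ext h.symm)
  · exact fun h => absurd hν.1 h

end Alternants

/-! ### GQ as a sum over injections, and its cancellation properties -/

section Embeddings

variable {K : Type*} [Field K] {n r : ℕ}

/-- The summand of `GQ_λ` belonging to an injection `e` that selects the variables
`x_{e(1)}, …, x_{e(r)}`. -/
def embTerm (b : K) (lam : Fin r → ℕ) (x : Fin n → K) (e : Fin r ↪ Fin n) : K :=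
  ∏ a, (dpow b (fun _ => 0) (x (e a)) (lam a) *
    ∏ k with ∀ a' ≤ a, k ≠ e a', oplus b (x (e a)) (x k) / ominus b (x (e a)) (x k))

/-- The sum of `embTerm` over all injections. -/
def embSum (b : K) (lam : Fin r → ℕ) (x : Fin n → K) : K := ∑ e, embTerm b lam x e

/-- The indices j > i are the complement of {1,…,i}, so the summand depends only on the restriction
of w to the first r indices. -/
theorem GQterm_eq_embTerm (b : K) (l : StrictPartition n) (x : Fin n → K)
    (w : Equiv.Perm (Fin n)) :
    GQterm b (fun _ => 0) l (fun i => x (w i)) =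
      embTerm b l.part x ((Fin.castLEEmb l.length_le).trans w.toEmbedding) := by
  rw [GQterm, embTerm, ← prod_mul_distrib]
  refine prod_congr rfl fun a _ => ?_
  congr 1
  refine prod_equiv w (fun j => ?_) fun j _ => rfl
  simp only [mem_Ioi, mem_filter, mem_univ, true_and, Function.Embedding.trans_apply,
    Fin.castLEEmb_apply, Equiv.coe_toEmbedding, ne_eq, EmbeddingLike.apply_eq_iff_eq]
  constructor
  · rintro h a' ha rfl
    exact absurd h (not_lt.2 ha)
  · intro h
    by_contra hj
    rw [not_lt] at hj
    have hjr : (j : ℕ) < l.length := lt_of_le_of_lt (Fin.le_def.1 hj) a.2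
    exact h ⟨j, hjr⟩ (Fin.le_def.2 (Fin.le_def.1 hj)) (Fin.ext rfl)

theorem card_perm_extending (h : r ≤ n) (e : Fin r ↪ Fin n) :
    Fintype.card {w : Equiv.Perm (Fin n) // (Fin.castLEEmb h).trans w.toEmbedding = e} =
      (n - r).factorial := by
  classical
  let e₀ : Set.range (Fin.castLEEmb h) ≃ Set.range e :=
    (Equiv.ofInjective _ (Fin.castLEEmb h).injective).symm.trans
      (Equiv.ofInjective _ e.injective)
  have h0 : ∀ a, (e₀ ⟨Fin.castLEEmb h a, a, rfl⟩ : Fin n) = e a := fun a => by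
    have : (⟨Fin.castLEEmb h a, a, rfl⟩ : Set.range (Fin.castLEEmb h)) =
        Equiv.ofInjective _ (Fin.castLEEmb h).injective a := rfl
    rw [this]
    exact congrArg Subtype.val (congrArg (Equiv.ofInjective _ e.injective)
      (Equiv.symm_apply_apply _ a))
  have h1 : {w : Equiv.Perm (Fin n) // (Fin.castLEEmb h).trans w.toEmbedding = e} ≃
      {w : Equiv.Perm (Fin n) // ∀ x : Set.range (Fin.castLEEmb h), w x = e₀ x} := by
    refine Equiv.subtypeEquivRight fun w => ⟨?_, fun hw => ?_⟩
    · rintro hw ⟨_, a, rfl⟩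
      rw [h0, ← hw]; rfl
    · ext1 a
      rw [← h0]
      exact hw ⟨_, a, rfl⟩
  have c1 : ∀ f : Fin r ↪ Fin n, Fintype.card ↥(Set.range f)ᶜ = n - r := fun f => by
    rw [Fintype.card_compl_set, Set.card_range_of_injective f.injective]
    simp
  rw [Fintype.card_congr (h1.trans (Equiv.Set.compl e₀)), Fintype.card_equiv
    (Fintype.equivOfCardEq (by rw [c1, c1])), c1]

theorem GQfactorial_eq_embSum [CharZero K] (b : K) (l : StrictPartition n) (x : Fin n → K) :
    GQfactorial b (fun _ => 0) l x = embSum b l.part x := by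
  classical
  rw [GQfactorial, embSum]
  have : ∑ w : Equiv.Perm (Fin n), GQterm b (fun _ => 0) l (fun i => x (w i)) =
      ((n - l.length).factorial : K) * ∑ e, embTerm b l.part x e := by
    rw [mul_sum, ← Finset.sum_fiberwise univ
      (fun w : Equiv.Perm (Fin n) => (Fin.castLEEmb l.length_le).trans w.toEmbedding)]
    refine sum_congr rfl fun e _ => ?_
    rw [sum_congr rfl (g := fun _ => embTerm b l.part x e), sum_const, nsmul_eq_mul,
      ← card_perm_extending l.length_le e, Fintype.card_subtype]
    intro w hw
    rw [GQterm_eq_embTerm, (mem_filter.1 hw).2]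
  rw [this, ← mul_assoc, one_div, inv_mul_cancel₀ (Nat.cast_ne_zero.2 (Nat.factorial_ne_zero _)),
    one_mul]

theorem exists_perm_extending (h : r ≤ n) (e : Fin r ↪ Fin n) :
    ∃ w : Equiv.Perm (Fin n), (Fin.castLEEmb h).trans w.toEmbedding = e := by
  have : 0 < Fintype.card {w : Equiv.Perm (Fin n) //
      (Fin.castLEEmb h).trans w.toEmbedding = e} := by
    rw [card_perm_extending]; exact Nat.factorial_pos _
  obtain ⟨w, hw⟩ := Fintype.card_pos_iff.1 this
  exact ⟨w, hw⟩

/-- Here t = ⊖t, because (1 + bt)² = 1; thus y ⊕ t and y ⊖ t agree. -/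
theorem oplus_div_ominus_of_two_torsion {b t y : K} (ht : oplus b t t = 0) (hy : y ≠ t) :
    oplus b y t / ominus b y t = 1 := by
  have h1 : (1 + b * t) * (1 + b * t) = 1 := by
    simp only [oplus] at ht; linear_combination b * ht
  have h2 : 1 + b * t ≠ 0 := left_ne_zero_of_mul_eq_one h1
  have h3 : oplus b y t = ominus b y t := by
    rw [ominus, eq_div_iff h2]
    simp only [oplus] at *
    linear_combination (y * b + 1) * ht
  rw [h3, div_self]
  rw [ominus]
  exact div_ne_zero (sub_ne_zero.2 hy) h2

theorem dpow_eq_zero {b t : K} (ht : oplus b t t = 0) (k : ℕ) : dpow b (fun _ => 0) t k = 0 := by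
  rw [dpow, ht, zero_mul]

/-- A variable specialized to a point of order two can be removed. -/
theorem embSum_cons {b t : K} (ht : oplus b t t = 0) (lam : Fin r → ℕ) (y : Fin n → K)
    (hy : ∀ k, y k ≠ t) : embSum b lam (Fin.cons t y : Fin (n + 1) → K) = embSum b lam y := by
  rw [embSum, embSum]
  refine (Fintype.sum_of_injective (fun e : Fin r ↪ Fin n => e.trans (Fin.succEmb n))
    (fun e e' h => ?_) _ _ (fun e he => ?_) fun e => ?_).symm
  · ext1 a
    exact Fin.succ_injective _ (DFunLike.congr_fun h a)
  · by_cases h0 : ∃ a, e a = 0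
    · obtain ⟨a, ha⟩ := h0
      refine prod_eq_zero (mem_univ a) ?_
      rw [ha, Fin.cons_zero, dpow_eq_zero ht, zero_mul]
    · push Not at h0
      exfalso
      refine he ⟨⟨fun a => (e a).pred (h0 a), fun a a' h => e.injective ?_⟩, ?_⟩
      · exact Fin.pred_inj.1 h
      · ext1 a
        exact Fin.succ_pred _ (h0 a)
  · rw [embTerm, embTerm]
    refine prod_congr rfl fun a _ => ?_
    simp only [Function.Embedding.trans_apply, Fin.coe_succEmb, Fin.cons_succ]
    congr 1
    simp only [prod_filter]
    rw [Fin.prod_univ_succ]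
    rw [if_pos (fun a' _ => (Fin.succ_ne_zero _).symm), Fin.cons_zero,
      oplus_div_ominus_of_two_torsion ht (hy _), one_mul]
    simp

theorem oplus_eq_zero_of_neg {b t : K} (h : 1 + b * t ≠ 0) : oplus b t (-t / (1 + b * t)) = 0 := by
  have hq := div_mul_cancel₀ (-t) h
  rw [oplus]; linear_combination hq

theorem oplus_comm {R : Type*} [CommRing R] (b x y : R) : oplus b x y = oplus b y x := by
  simp only [oplus]; ring

/-- Replacing t by ⊖t exchanges y ⊕ t and y ⊖ t, so the two fractions are inverse to each other. -/
theorem oplus_div_ominus_cancel {b t y : K} (h : 1 + b * t ≠ 0) (h1 : y ≠ t)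
    (h2 : y ≠ -t / (1 + b * t)) :
    (oplus b y t / ominus b y t) *
      (oplus b y (-t / (1 + b * t)) / ominus b y (-t / (1 + b * t))) = 1 := by
  have hq := div_mul_cancel₀ (-t) h
  have e1 : oplus b y (-t / (1 + b * t)) = ominus b y t := by
    rw [oplus, ominus, eq_div_iff h]; linear_combination (1 + b * y) * hq
  have e2 : ominus b y (-t / (1 + b * t)) = oplus b y t := by
    have h3 : (1 + b * (-t / (1 + b * t))) * (1 + b * t) = 1 := by linear_combination b * hq
    rw [oplus, ominus, div_eq_iff (left_ne_zero_of_mul_eq_one h3)]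
    linear_combination (-1 : K) * hq - y * h3
  have n1 : ominus b y t ≠ 0 := div_ne_zero (sub_ne_zero.2 h1) h
  have n2 : oplus b y t ≠ 0 := by
    intro h0
    refine h2 ?_
    rw [eq_div_iff h]
    simp only [oplus] at h0
    linear_combination h0
  rw [e1, e2]
  field_simp

/-- Whichever of i and j is selected first, the other index still occurs in its product, with
numerator x_i ⊕ x_j. -/
theorem embTerm_eq_zero {b : K} (lam : Fin r → ℕ) {x : Fin n → K} (e : Fin r ↪ Fin n)
    {i j : Fin n} (hij : i ≠ j) (h : oplus b (x i) (x j) = 0) {a : Fin r} (ha : e a = i) :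
    embTerm b lam x e = 0 := by
  by_cases hj : ∃ a' ≤ a, e a' = j
  · obtain ⟨a', ha', hj⟩ := hj
    refine prod_eq_zero (mem_univ a') (mul_eq_zero_of_right _ (prod_eq_zero (i := i) ?_ ?_))
    · simp only [mem_filter, mem_univ, true_and]
      rintro c hc rfl
      have : a = c := e.injective ha
      subst this
      exact hij (by rw [← hj, le_antisymm hc ha'])
    · rw [hj, oplus_comm, h, zero_div]
  · push Not at hj
    refine prod_eq_zero (mem_univ a) (mul_eq_zero_of_right _ (prod_eq_zero (i := j) ?_ ?_))
    · simp only [mem_filter, mem_univ, true_and]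
      exact fun c hc => (hj c hc).symm
    · rw [ha, h, zero_div]

/-- If `x_i = t` and `x_j = ⊖t`, then `GQ_λ` lies in every field that contains `β` and the other
variables. -/
theorem embSum_mem {b t : K} (F : Subfield K) (hb : b ∈ F) (lam : Fin r → ℕ) {x : Fin n → K}
    (hx : Function.Injective x) {i j : Fin n} (hij : i ≠ j) (ht : 1 + b * t ≠ 0)
    (hi : x i = t) (hj : x j = -t / (1 + b * t)) (hF : ∀ k, k ≠ i → k ≠ j → x k ∈ F) :
    embSum b lam x ∈ F := by
  have h0 : oplus b (x i) (x j) = 0 := by rw [hi, hj]; exact oplus_eq_zero_of_neg ht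
  have hop : ∀ {y z}, y ∈ F → z ∈ F → oplus b y z ∈ F := fun hy hz =>
    add_mem (add_mem hy hz) (mul_mem (mul_mem hb hy) hz)
  refine sum_mem fun e _ => ?_
  by_cases hei : ∃ a, e a = i
  · obtain ⟨a, ha⟩ := hei
    rw [embTerm_eq_zero lam e hij h0 ha]; exact zero_mem F
  by_cases hej : ∃ a, e a = j
  · obtain ⟨a, ha⟩ := hej
    rw [embTerm_eq_zero lam e hij.symm (by rwa [oplus_comm]) ha]; exact zero_mem F
  push Not at hei hej
  refine prod_mem fun a _ => ?_
  have ha := hF _ (hei a) (hej a)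
  refine mul_mem (mul_mem (hop ha ha) (prod_mem fun _ _ => hop ha (zero_mem F))) ?_
  -- The injection avoids i and j, so both indices occur in the product; their two factors cancel
  -- and everything left lies in `F`.
  rw [← mul_prod_erase _ _ (a := i), ← mul_prod_erase _ _ (a := j), ← mul_assoc, hi, hj,
    oplus_div_ominus_cancel ht (by rw [← hi]; exact hx.ne (hei a))
      (by rw [← hj]; exact hx.ne (hej a)), one_mul]
  · refine prod_mem fun k hk => ?_
    simp only [mem_erase] at hk
    have hk' := hF k hk.2.1 hk.1
    exact div_mem (hop ha hk') (div_mem (sub_mem ha hk') (add_mem (one_mem F) (mul_mem hb hk')))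
  · simpa [hij.symm] using fun a' _ => (hej a').symm
  · simpa using fun a' _ => (hei a').symm

end Embeddings

/-! ### Polynomiality and symmetry of GQ -/

section Numerators

variable {n : ℕ}

/-- The product of `GQterm` with a Vandermonde determinant, which makes sense in any commutative
ring. -/
def GQnum {R : Type*} [CommRing R] (b : R) (l : StrictPartition n) (x : Fin n → R) : R :=
  (∏ i : Fin l.length, dpow b (fun _ => 0) (x (Fin.castLE l.length_le i)) (l.part i)) *
    ∏ i : Fin n, ∏ j ∈ Ioi i,
      if (i : ℕ) < l.length then -(oplus b (x i) (x j) * (1 + b * x j)) else x j - x i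

theorem map_oplus {R S : Type*} [CommRing R] [CommRing S] (φ : R →+* S) (b x y : R) :
    φ (oplus b x y) = oplus (φ b) (φ x) (φ y) := by simp [oplus]

theorem map_GQnum {R S : Type*} [CommRing R] [CommRing S] (φ : R →+* S) (b : R)
    (l : StrictPartition n) (x : Fin n → R) :
    φ (GQnum b l x) = GQnum (φ b) l (fun i => φ (x i)) := by
  simp [GQnum, map_prod, map_oplus, dpow, apply_ite φ]

theorem prod_castLE {R : Type*} [CommRing R] {r : ℕ} (h : r ≤ n) (f : Fin n → R) :
    ∏ a : Fin r, f (Fin.castLE h a) = ∏ i : Fin n, if (i : ℕ) < r then f i else 1 := by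
  refine Fintype.prod_of_injective (Fin.castLE h) (Fin.castLE_injective h) _ _ (fun i hi => ?_)
    fun a => ?_
  · rw [if_neg]
    exact fun hir => hi ⟨⟨i, hir⟩, rfl⟩
  · rw [if_pos]; simp

/-- Each denominator x_i ⊖ x_j = (x_i - x_j)/(1 + βx_j) with i ≤ r cancels one Vandermonde factor
x_j - x_i up to sign; the factors with i > r survive. -/
theorem vandermonde_mul_GQterm {K : Type*} [Field K] (b : K) (l : StrictPartition n)
    {x : Fin n → K} (hx : Function.Injective x) :
    (Matrix.vandermonde x).det * GQterm b (fun _ => 0) l x = GQnum b l x := by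
  rw [GQterm, GQnum, Matrix.det_vandermonde, mul_left_comm]
  congr 1
  rw [prod_castLE l.length_le (fun i => ∏ j ∈ Ioi i, oplus b (x i) (x j) / ominus b (x i) (x j)),
    ← prod_mul_distrib]
  refine prod_congr rfl fun i _ => ?_
  split_ifs
  · rw [← prod_mul_distrib]
    refine prod_congr rfl fun j hj => ?_
    have h1 : x j - x i ≠ 0 := sub_ne_zero.2 (hx.ne (mem_Ioi.1 hj).ne')
    rw [ominus, div_div_eq_mul_div, ← neg_sub (x j) (x i), div_neg, mul_neg,
      mul_div_cancel₀ _ h1]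
  · rw [mul_one]

theorem det_vandermonde_perm {R : Type*} [CommRing R] (x : Fin n → R)
    (w : Equiv.Perm (Fin n)) : (Matrix.vandermonde (fun i => x (w i))).det =
      (Equiv.Perm.sign w : ℤ) • (Matrix.vandermonde x).det := by
  rw [zsmul_eq_mul, ← Matrix.det_permute]
  rfl

theorem sign_smul_GQnum {K : Type*} [Field K] (b : K) (l : StrictPartition n) {x : Fin n → K}
    (hx : Function.Injective x) (w : Equiv.Perm (Fin n)) :
    (Equiv.Perm.sign w : ℤ) • GQnum b l (fun i => x (w i)) =
      (Matrix.vandermonde x).det * GQterm b (fun _ => 0) l (fun i => x (w i)) := by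
  rw [← vandermonde_mul_GQterm b l (x := fun i => x (w i)) (hx.comp w.injective),
    det_vandermonde_perm, smul_mul_assoc, smul_smul, ← Units.val_mul, Int.units_mul_self,
    Units.val_one, one_smul]

/-- The numerator of `GQ_λ` before antisymmetrization. -/
def numPoly (l : StrictPartition n) : PolyRing n := GQnum (C β) l X

/-- The Vandermonde determinant `∏_{i<j} (x_j - x_i)`. -/
def vdm (n : ℕ) : PolyRing n := (Matrix.vandermonde (X : Fin n → PolyRing n)).det

theorem map_det_vandermonde {R S : Type*} [CommRing R] [CommRing S] (φ : R →+* S)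
    (x : Fin n → R) :
    φ (Matrix.vandermonde x).det = (Matrix.vandermonde (fun i => φ (x i))).det := by
  simp [Matrix.det_vandermonde, map_prod]

theorem rename_vdm (w : Equiv.Perm (Fin n)) :
    rename w (vdm n) = (Equiv.Perm.sign w : ℤ) • vdm n := by
  have := map_det_vandermonde (rename w : PolyRing n →ₐ[Coeff] PolyRing n).toRingHom X
  rw [vdm, ← det_vandermonde_perm]
  simpa using this

theorem vdm_ne_zero (n : ℕ) : vdm n ≠ 0 := Matrix.det_vandermonde_ne_zero_iff.2 (X_injective)

theorem map_antisymmetrize_numPoly {L : Type*} [Field L] (φ : PolyRing n →+* L)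
    (hφ : Function.Injective fun i => φ (X i)) (l : StrictPartition n) :
    φ (antisymmetrize (numPoly l)) = φ (vdm n) * ∑ w : Equiv.Perm (Fin n),
      GQterm (φ (C β)) (fun _ => 0) l (fun i => φ (X (w i))) := by
  rw [antisymmetrize, map_sum, mul_sum]
  refine sum_congr rfl fun w _ => ?_
  have h1 : φ (rename w (numPoly l)) = GQnum (φ (C β)) l (fun i => φ (X (w i))) := by
    have := map_GQnum (φ.comp (rename w : PolyRing n →ₐ[Coeff] PolyRing n).toRingHom) (C β) l X
    simpa [numPoly] using this
  rw [map_zsmul, h1, sign_smul_GQnum (φ (C β)) l hφ w, vdm, map_det_vandermonde]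

theorem map_antisymmetrize_numPoly' {L : Type*} [Field L] [CharZero L] (φ : PolyRing n →+* L)
    (hφ : Function.Injective fun i => φ (X i)) (l : StrictPartition n) :
    φ (antisymmetrize (numPoly l)) = (n - l.length).factorial *
      (φ (vdm n) * GQfactorial (φ (C β)) (fun _ => 0) l (fun i => φ (X i))) := by
  have h : ((n - l.length).factorial : L) ≠ 0 := Nat.cast_ne_zero.2 (Nat.factorial_ne_zero _)
  rw [map_antisymmetrize_numPoly φ hφ, GQfactorial]
  field_simp

/-- The transposition of i and j shows that P equals its negative on x_i = x_j, hence vanishes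
there; the differences x_j - x_i are pairwise coprime. -/
theorem IsAlternating.vdm_dvd {P : PolyRing n} (hP : IsAlternating P) : vdm n ∣ P := by
  rw [vdm, Matrix.det_vandermonde, prod_sigma']
  refine prod_dvd_of_isRelPrime ?_ ?_
  · rintro ⟨i, j⟩ h1 ⟨k, l⟩ h2 hne
    simp only [coe_sigma, Set.mem_sigma_iff, mem_coe, mem_Ioi] at h1 h2
    refine isRelPrime_X_sub_X h1.2 h2.2 fun h => hne ?_
    simp only [Prod.mk.injEq] at h
    rw [h.1, h.2]
  · rintro ⟨i, j⟩ h1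
    simp only [mem_sigma, mem_univ, mem_Ioi, true_and] at h1
    let φ : PolyRing n →ₐ[Coeff] PolyRing n := aeval (Function.update X j (X i))
    have h2 : φ P = 0 := by
      have h3 : φ (rename (Equiv.swap i j) P) = φ P := by
        rw [show φ (rename (Equiv.swap i j) P) = (φ.comp (rename (Equiv.swap i j))) P from rfl]
        congr 1
        ext1 k
        simp only [AlgHom.comp_apply, rename_X, φ, aeval_X]
        by_cases hi : k = i
        · subst hi; simp [h1.ne]
        by_cases hj : k = j
        · subst hj; simp [Ne.symm hi]
        · rw [Equiv.swap_apply_of_ne_of_ne hi hj]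
      rw [hP, Equiv.Perm.sign_swap h1.ne] at h3
      simp at h3
      exact self_eq_neg.1 h3.symm
    have h4 := dvd_of_root (j := j) (u := (1 : PolyRing n)) (v := -X i) (FreeOf.one j)
      (FreeOf.var h1.ne).neg isRelPrime_one_right φ.toRingHom (by simp [φ, h1.ne])
      (fun g hg h0 => ?_) h2
    · rwa [one_mul, neg_add_eq_sub] at h4
    · have := hg.map_eq (φ := φ.toRingHom) (ψ := RingHom.id _) (fun r => by simp [φ]) fun k hk => by
        simp [φ, hk]
      rw [h0] at this
      exact this.symm

instance : CharZero (RatField n) :=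
  charZero_of_injective_algebraMap (IsFractionRing.injective (PolyRing n) (RatField n))

theorem algebraMap_X_injective :
    Function.Injective fun i => algebraMap (PolyRing n) (RatField n) (X i) :=
  (IsFractionRing.injective (PolyRing n) (RatField n)).comp X_injective

/-- The sum over injections is used here because it has no denominator (n-r)!, so integrality over
ℤ[β] is visible. -/
theorem exists_vdm_mul_GQ (l : StrictPartition n) :
    ∃ P, algebraMap (PolyRing n) (RatField n) P =
      algebraMap (PolyRing n) (RatField n) (vdm n) * GQ l := by
  rw [GQ, GQfactorial_eq_embSum, embSum, mul_sum]
  have : ∀ e : Fin l.length ↪ Fin n, ∃ P, algebraMap (PolyRing n) (RatField n) P =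
      algebraMap (PolyRing n) (RatField n) (vdm n) *
        embTerm (algebraMap (PolyRing n) (RatField n) (C β)) l.part
          (fun i => algebraMap (PolyRing n) (RatField n) (X i)) e := fun e => by
    obtain ⟨w, hw⟩ := exists_perm_extending l.length_le e
    refine ⟨(Equiv.Perm.sign w : ℤ) • GQnum (C β) l (fun i => X (w i)), ?_⟩
    rw [← hw, ← GQterm_eq_embTerm, map_zsmul, map_GQnum,
      sign_smul_GQnum _ l algebraMap_X_injective w, vdm, map_det_vandermonde]
  choose P hP using this
  exact ⟨∑ e, P e, by rw [map_sum]; exact sum_congr rfl fun e _ => hP e⟩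

theorem factorial_smul_injective (k : ℕ) :
    Function.Injective fun P : PolyRing n => ((k.factorial : ℕ) : PolyRing n) * P :=
  mul_right_injective₀ (Nat.cast_ne_zero.2 (Nat.factorial_ne_zero _))

/-- The numerator P is alternating because (n-r)!·P is an antisymmetrization and the factorial can
be cancelled. So the Vandermonde determinant divides P. -/
theorem exists_GQ_eq (l : StrictPartition n) :
    ∃ f, algebraMap (PolyRing n) (RatField n) f = GQ l := by
  obtain ⟨P, hP⟩ := exists_vdm_mul_GQ l
  have h1 : antisymmetrize (numPoly l) = ((n - l.length).factorial : PolyRing n) * P := by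
    apply IsFractionRing.injective (PolyRing n) (RatField n)
    rw [map_antisymmetrize_numPoly' _ algebraMap_X_injective, map_mul, hP, map_natCast]
    rfl
  have h2 : IsAlternating P := fun w => by
    apply factorial_smul_injective (n - l.length)
    have h3 := IsAlternating.antisymmetrize (numPoly l) w
    rw [h1, map_mul, map_natCast] at h3
    simp only [mul_smul_comm]
    exact h3
  obtain ⟨f, rfl⟩ := h2.vdm_dvd
  refine ⟨f, ?_⟩
  rw [map_mul] at hP
  exact mul_left_cancel₀ ((map_ne_zero_iff _
    (IsFractionRing.injective (PolyRing n) (RatField n))).2 (vdm_ne_zero n)) hP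

/-- The polynomial `GQ_λ(x₁, …, xₙ)`. -/
def GQpoly (l : StrictPartition n) : PolyRing n := (exists_GQ_eq l).choose

theorem algebraMap_GQpoly (l : StrictPartition n) :
    algebraMap (PolyRing n) (RatField n) (GQpoly l) = GQ l := (exists_GQ_eq l).choose_spec

theorem antisymmetrize_numPoly (l : StrictPartition n) :
    antisymmetrize (numPoly l) = ((n - l.length).factorial : PolyRing n) * (vdm n * GQpoly l) := by
  apply IsFractionRing.injective (PolyRing n) (RatField n)
  rw [map_antisymmetrize_numPoly' _ algebraMap_X_injective, map_mul, map_mul, algebraMap_GQpoly,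
    map_natCast]
  rfl

/-- The value of `GQ_λ` at a point with distinct coordinates is given by the defining formula. -/
theorem map_GQpoly {L : Type*} [Field L] [CharZero L] (φ : PolyRing n →+* L)
    (hφ : Function.Injective fun i => φ (X i)) (l : StrictPartition n) :
    φ (GQpoly l) = embSum (φ (C β)) l.part (fun i => φ (X i)) := by
  have h1 := map_antisymmetrize_numPoly' φ hφ l
  have h : ((n - l.length).factorial : L) ≠ 0 := Nat.cast_ne_zero.2 (Nat.factorial_ne_zero _)
  rw [antisymmetrize_numPoly, map_mul, map_mul, map_natCast, GQfactorial_eq_embSum] at h1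
  refine mul_left_cancel₀ ?_ (mul_left_cancel₀ h h1)
  rw [vdm, map_det_vandermonde]
  exact Matrix.det_vandermonde_ne_zero_iff.2 hφ

theorem GQpoly_isSymmetric (l : StrictPartition n) : (GQpoly l).IsSymmetric := by
  intro w
  apply factorial_smul_injective (n - l.length)
  apply mul_right_injective₀ (vdm_ne_zero n)
  have h := IsAlternating.antisymmetrize (numPoly l) w
  rw [antisymmetrize_numPoly, map_mul, map_mul, map_natCast, rename_vdm] at h
  have h3 := congrArg (fun Q => (Equiv.Perm.sign w : ℤ) • Q) h
  simp only [mul_smul_comm, smul_mul_assoc, smul_smul, ← Units.val_mul, Int.units_mul_self,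
    Units.val_one, one_smul] at h3
  simp only
  rw [mul_left_comm, h3, mul_left_comm]

end Numerators

/-! ### Cancellation as divisibility; membership of GQ in GΓ_{n,+} -/

section Cancellation

variable {n : ℕ}

/-- The substitution `xᵢ = xⱼ = 0`. -/
def zeroPair (i j : Fin n) : PolyRing n →ₐ[Coeff] PolyRing n :=
  aeval (fun k => if k = i ∨ k = j then 0 else X k)

theorem zeroPair_comm (i j : Fin n) : zeroPair i j = zeroPair j i := by
  simp only [zeroPair, or_comm]

theorem rename_pairSum {m : ℕ} (f : Fin n → Fin m) (i j : Fin n) :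
    rename f (pairSum i j) = pairSum (f i) (f j) := by
  simp [pairSum, oplus]

theorem rename_zeroPair (w : Equiv.Perm (Fin n)) (i j : Fin n) (F : PolyRing n) :
    rename w (zeroPair i j F) = zeroPair (w i) (w j) (rename w F) := by
  have : (rename w : PolyRing n →ₐ[Coeff] PolyRing n).comp (zeroPair i j) =
      (zeroPair (w i) (w j)).comp (rename w) := by
    ext1 k
    by_cases h : k = i ∨ k = j <;> simp [zeroPair, h]
  exact DFunLike.congr_fun this F

/-- Symmetric polynomials `F` with `xᵢ ⊕ xⱼ ∣ F - F|_{xᵢ = xⱼ = 0}` for all `i` and `j`. For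
`i ≠ j` this is the cancellation property, for `i = j` it is divisibility by `t ⊕ t`. -/
def divisibilityModule (n : ℕ) : Submodule Coeff (PolyRing n) where
  carrier := {F | F.IsSymmetric ∧ ∀ i j, pairSum i j ∣ F - zeroPair i j F}
  zero_mem' := ⟨MvPolynomial.IsSymmetric.zero, fun i j => by simp⟩
  add_mem' ha hb := ⟨ha.1.add hb.1, fun i j => by
    rw [map_add, add_sub_add_comm]; exact dvd_add (ha.2 i j) (hb.2 i j)⟩
  smul_mem' c _ ha := ⟨ha.1.smul c, fun i j => by
    rw [map_smul, ← smul_sub]; exact dvd_smul_of_dvd c (ha.2 i j)⟩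

theorem algebraMap_ratFunc_injective : Function.Injective
    (algebraMap (RatField n)[X] (RatFunc (RatField n))) :=
  RatFunc.algebraMap_injective _

theorem polyRing_algebraMap_injective :
    Function.Injective (algebraMap (PolyRing n) (RatField n)) :=
  IsFractionRing.injective (PolyRing n) (RatField n)

/-- The substitution `xᵢ = t`, with values in polynomials in `t`. -/
def substVar (i : Fin n) : PolyRing n →+* RatFunc (RatField n) :=
  (algebraMap (RatField n)[X] (RatFunc (RatField n))).comp
    ((Polynomial.mapRingHom (algebraMap (PolyRing n) (RatField n))).comp
      (sepVar i : PolyRing n →ₐ[Coeff] _).toRingHom)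

theorem substVar_apply (i : Fin n) (g : PolyRing n) : substVar i g =
    algebraMap (RatField n)[X] (RatFunc (RatField n))
      ((sepVar i g).map (algebraMap (PolyRing n) (RatField n))) := rfl

theorem substVar_injective (i : Fin n) : Function.Injective (substVar i) := by
  intro f g h
  have h1 := Polynomial.map_injective _ polyRing_algebraMap_injective
    (algebraMap_ratFunc_injective h)
  rw [← eval_sepVar i f, ← eval_sepVar i g]
  exact congrArg _ h1

theorem cancelSubst_eq_substVar {i j : Fin n} {g : PolyRing n} (hg : FreeOf j g) :
    cancelSubst i j g = substVar i g := by
  refine hg.map_eq (fun r => ?_) fun k hk => ?_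
  · simp [cancelSubst, substVar_apply, coeffHom]
  · by_cases hi : k = i
    · subst hi
      simp [cancelSubst, substVar_apply, cancelPoint]
    · simp [cancelSubst, substVar_apply, cancelPoint, hi, hk, sepVar_X_of_ne hi]

theorem one_add_beta_X_ne_zero (i : Fin n) : (1 + coeffHom n β * RatFunc.X) ≠ 0 := by
  have h : substVar i (1 + C β * X i) = 1 + coeffHom n β * RatFunc.X := by
    simp [substVar_apply, coeffHom]
  rw [← h, map_ne_zero_iff _ (substVar_injective i)]
  intro h0
  have := congrArg constantCoeff h0
  simp at this

theorem cancelSubst_pairSum {i j : Fin n} (hij : i ≠ j) : cancelSubst i j (pairSum i j) = 0 := by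
  have h := one_add_beta_X_ne_zero i
  have h1 := oplus_eq_zero_of_neg h
  rw [pairSum, map_oplus]
  simpa [cancelSubst, cancelPoint, hij.symm] using h1

/-- The constant value must be the one at t = 0, where ⊖t vanishes too. Then F - F|_{x_i = x_j = 0}
is killed by the substitution, and `dvd_of_root` applies with x_i ⊕ x_j = x_i + (1 + βx_i)x_j. -/
theorem pairSum_dvd_of_cancel {i j : Fin n} (hij : i ≠ j) {F : PolyRing n}
    (hF : cancelSubst i j F ∈ (RatFunc.C : RatField n →+* RatFunc (RatField n)).range) :
    pairSum i j ∣ F - zeroPair i j F := by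
  have hu : FreeOf j (1 + C β * X i : PolyRing n) :=
    (FreeOf.one j).add ((FreeOf.const j β).mul (FreeOf.var hij))
  have hv : FreeOf j (X i : PolyRing n) := FreeOf.var hij
  obtain ⟨c, hc⟩ := hF
  have hroot := cancelSubst_pairSum hij
  have hc' : c = algebraMap _ _ (zeroPair i j F) := by
    -- Pseudo-division avoids evaluating a rational function: (1 + βt)^N c = g(t) is an identity of
    -- polynomials in t, and t = 0 gives c = g(0).
    obtain ⟨N, g, hg, q, e⟩ := exists_pow_mul_sub hu hv F
    rw [← pairSum_eq] at e
    have e1 := congrArg (cancelSubst i j) e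
    rw [map_mul, hroot, zero_mul, map_sub, sub_eq_zero, map_mul, map_pow,
      cancelSubst_eq_substVar hu, cancelSubst_eq_substVar hg, ← hc, ← map_pow, substVar_apply,
      substVar_apply, ← RatFunc.algebraMap_C, ← map_mul] at e1
    have e2 := congrArg (Polynomial.eval 0) (algebraMap_ratFunc_injective e1)
    have e3 : zeroPair i j F = zeroPair i j g := by
      have := congrArg (zeroPair i j) e
      have h0 : zeroPair i j (pairSum i j) = 0 := by simp [zeroPair, pairSum, oplus]
      have h1 : zeroPair i j (1 + C β * X i) = 1 := by simp [zeroPair]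
      rwa [map_mul, h0, zero_mul, map_sub, map_mul, map_pow, h1, one_pow, one_mul,
        sub_eq_zero] at this
    have e4 : zeroPair i j g = (sepVar i g).eval 0 := by
      refine hg.map_eq (φ := (zeroPair i j).toRingHom)
        (ψ := (Polynomial.evalRingHom 0).comp (sepVar i : PolyRing n →ₐ[Coeff] _).toRingHom)
        (fun r => by simp) fun k hk => ?_
      by_cases hi : k = i
      · subst hi; simp [zeroPair]
      · simp [zeroPair, hi, hk, sepVar_X_of_ne hi]
    rw [e3, e4]
    simpa [Polynomial.eval_map, Polynomial.eval₂_at_zero, Polynomial.coeff_zero_eq_eval_zero]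
      using e2
  have h1 : cancelSubst i j (zeroPair i j F) = RatFunc.C (algebraMap _ _ (zeroPair i j F)) := by
    have : (cancelSubst i j).comp (zeroPair i j).toRingHom =
        (RatFunc.C.comp (algebraMap _ (RatField n))).comp (zeroPair i j).toRingHom := by
      refine MvPolynomial.ringHom_ext (fun r => ?_) fun k => ?_
      · simp [cancelSubst, coeffHom]
      · by_cases hk : k = i ∨ k = j
        · simp [zeroPair, hk]
        · have hk' := not_or.1 hk
          simp [zeroPair, cancelSubst, cancelPoint, hk'.1, hk'.2]
    exact RingHom.congr_fun this F
  rw [pairSum_eq]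
  refine dvd_of_root hu hv (isRelPrime_X_one_add i) (cancelSubst i j)
    (by rw [← pairSum_eq]; exact hroot) (fun g hg h0 => ?_) ?_
  · rw [cancelSubst_eq_substVar hg] at h0
    exact (map_eq_zero_iff _ (substVar_injective i)).1 h0
  · rw [map_sub, h1, ← hc, hc', sub_self]

theorem mem_divisibilityModule [NeZero n] {F : PolyRing n} (hF : F ∈ GGammaPlus n) :
    F ∈ divisibilityModule n := by
  obtain ⟨⟨hs, hc⟩, ht⟩ := hF
  refine ⟨hs, fun i j => ?_⟩
  rcases lt_trichotomy i j with h | h | h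
  · exact pairSum_dvd_of_cancel h.ne (hc i j h)
  · subst h
    have h1 : zeroFirst n = zeroPair (0 : Fin n) 0 := by simp [zeroFirst, zeroPair]
    have h2 := map_dvd (rename (Equiv.swap 0 i)) ht
    rw [h1, show tt n = pairSum 0 0 from rfl, rename_pairSum, map_sub, rename_zeroPair,
      hs, Equiv.swap_apply_left] at h2
    exact h2
  · rw [pairSum_comm, zeroPair_comm]
    exact pairSum_dvd_of_cancel h.ne (hc j i h)

instance : CharZero (RatFunc (RatField n)) :=
  charZero_of_injective_algebraMap (algebraMap (RatField n) (RatFunc (RatField n))).injective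

/-- The formula for GQ needs distinct coordinates. If x_k had the value ⊖t, then x_i ⊕ x_k would be
mapped to zero, but it is free of x_j and nonzero. -/
theorem cancelSubst_X_injective {i j : Fin n} (hij : i ≠ j) :
    Function.Injective fun k => cancelSubst i j (X k) := by
  have hne : ∀ k, k ≠ j → cancelSubst i j (X k) ≠ cancelSubst i j (X j) := fun k hk h => by
    have h1 : cancelSubst i j (pairSum i k) = 0 := by
      rw [← cancelSubst_pairSum hij, pairSum, pairSum, map_oplus, map_oplus, h]
    rw [cancelSubst_eq_substVar (freeOf_pairSum hij hk),
      map_eq_zero_iff _ (substVar_injective i)] at h1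
    exact pairSum_ne_zero i k h1
  intro k l h
  by_cases hk : k = j
  · by_cases hl : l = j
    · rw [hk, hl]
    · subst hk; exact absurd h.symm (hne l hl)
  · by_cases hl : l = j
    · subst hl; exact absurd h (hne k hk)
    · simp only at h
      rw [cancelSubst_eq_substVar (FreeOf.var hk), cancelSubst_eq_substVar (FreeOf.var hl)] at h
      exact X_injective (substVar_injective i h)

theorem cancelSubst_GQpoly_mem {i j : Fin n} (hij : i ≠ j) (l : StrictPartition n) :
    cancelSubst i j (GQpoly l) ∈
      (RatFunc.C : RatField n →+* RatFunc (RatField n)).range := by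
  rw [map_GQpoly _ (cancelSubst_X_injective hij)]
  have hC : cancelSubst i j (C β) = coeffHom n β := by simp [cancelSubst]
  rw [hC]
  refine embSum_mem (RatFunc.C : RatField n →+* RatFunc (RatField n)).fieldRange ⟨_, rfl⟩ l.part
    (cancelSubst_X_injective hij) hij (t := RatFunc.X) (one_add_beta_X_ne_zero i) ?_ ?_ fun k hi hj => ?_
  · simp [cancelSubst, cancelPoint]
  · simp [cancelSubst, cancelPoint, hij.symm, coeffHom]
  · exact ⟨algebraMap (PolyRing n) _ (X k), by simp [cancelSubst, cancelPoint, hi, hj]⟩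

/-- A specialization of `x₁` to a point of order two. -/
theorem map_GQpoly_of_two_torsion {L : Type*} [Field L] [CharZero L] (φ : PolyRing (n + 1) →+* L)
    (hφ : Function.Injective fun i => φ (X i))
    (h0 : oplus (φ (C β)) (φ (X 0)) (φ (X 0)) = 0) (l : StrictPartition (n + 1)) :
    φ (GQpoly l) = embSum (φ (C β)) l.part (fun i : Fin n => φ (X i.succ)) := by
  rw [map_GQpoly φ hφ, ← embSum_cons h0 l.part (fun i : Fin n => φ (X i.succ))
    fun k h => (Fin.succ_ne_zero k) (hφ h)]
  congr 1
  ext i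
  refine Fin.cases ?_ (fun k => ?_) i <;> simp

/-- The roots of t ⊕ t = t(2 + βt) are 0 and -2/β, and at both of them x₁ drops out of GQ. So the
difference is divisible by the two coprime factors t and 2 + βt. -/
theorem tt_dvd_GQpoly (l : StrictPartition (n + 1)) :
    tt (n + 1) ∣ GQpoly l - zeroFirst (n + 1) (GQpoly l) := by
  set ι := algebraMap (PolyRing (n + 1)) (RatField (n + 1)) with hι
  have hb : ι (C β) ≠ 0 := by
    rw [map_ne_zero_iff _ polyRing_algebraMap_injective]; simp
  let ψ : RatField (n + 1) → PolyRing (n + 1) →+* RatField (n + 1) := fun t =>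
    eval₂Hom ((ι).comp C)
      (Fin.cons t fun k : Fin n =>
        ι (X k.succ))
  have hC : ∀ t r, ψ t (C r) = ι (C r) :=
    fun t r => by simp [ψ]
  have hC2 : ι (C 2) = 2 := map_ofNat (ι.comp C) 2
  have h0 : ∀ t, ψ t (X 0) = t := fun t => by simp [ψ]
  have hS : ∀ t (k : Fin n), ψ t (X k.succ) =
      ι (X k.succ) := fun t k => by simp [ψ]
  have hval : ∀ t, (∀ k : Fin n, ι (X k.succ) ≠ t) →
      oplus (ι (C β)) t t = 0 →
      ψ t (GQpoly l) = embSum (ι (C β)) l.part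
        (fun i : Fin n => ι (X i.succ)) := fun t ht ht' => by
    rw [map_GQpoly_of_two_torsion (ψ t) ?_ (by rw [hC, h0, ht']), hC]
    · simp only [hS]
    · intro i k
      refine Fin.cases ?_ (fun i => ?_) i <;> refine Fin.cases ?_ (fun k => ?_) k
      · simp
      · simp only [h0, hS]; exact fun h => absurd h.symm (ht k)
      · simp only [h0, hS]; exact fun h => absurd h (ht i)
      · simp only [hS]; exact fun h => X_injective (polyRing_algebraMap_injective h)
  have hz : ∀ t, ψ t (zeroFirst (n + 1) (GQpoly l)) = ψ 0 (GQpoly l) := fun t => by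
    have : (ψ t).comp (zeroFirst (n + 1)).toRingHom = ψ 0 := by
      refine MvPolynomial.ringHom_ext (fun r => ?_) fun k => ?_
      · simp [ψ]
      · refine Fin.cases ?_ (fun k => ?_) k <;> simp [zeroFirst, ψ]
    exact RingHom.congr_fun this _
  have e0 := hval 0 (fun k => by
    rw [map_ne_zero_iff _ polyRing_algebraMap_injective]; exact X_ne_zero _) (by simp [oplus])
  -- The point -2/β differs from every variable: x_k β = -2 fails in the constant term.
  have e1 := hval (-2 / ι (C β)) (fun k h => by
    rw [eq_div_iff hb, ← map_mul] at h
    have h1 : (X k.succ * C β : PolyRing (n + 1)) = -C 2 :=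
      polyRing_algebraMap_injective (by rw [h, map_neg, ← hι, hC2])
    have h2 := congrArg constantCoeff h1
    simp at h2) (by rw [oplus]; field_simp; ring)
  have hinj : ∀ t (g : PolyRing (n + 1)), FreeOf 0 g → ψ t g = 0 → g = 0 := fun t g hg h => by
    rw [hg.map_eq (ψ := ι) (hC t) fun k hk => ?_] at h
    · exact (map_eq_zero_iff _ polyRing_algebraMap_injective).1 h
    · obtain ⟨k, rfl⟩ := Fin.exists_succ_eq.2 hk
      exact hS t k
  have d0 : (0 : PolyRing (n + 1)) + 1 * X 0 ∣ GQpoly l - zeroFirst (n + 1) (GQpoly l) := by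
    refine dvd_of_root (FreeOf.one 0) ?_ isRelPrime_one_right (ψ 0) (by simp [h0]) (hinj 0) ?_
    · simpa using FreeOf.const (R := Coeff) (0 : Fin (n + 1)) 0
    · rw [map_sub, hz, sub_self]
  have d1 : (C 2 : PolyRing (n + 1)) + C β * X 0 ∣
      GQpoly l - zeroFirst (n + 1) (GQpoly l) := by
    refine dvd_of_root (FreeOf.const 0 β) (FreeOf.const 0 2) isRelPrime_two_beta
      (ψ (-2 / ι (C β))) ?_ (hinj _) ?_
    · rw [map_add, map_mul, hC, hC, h0, mul_div_cancel₀ _ hb, hC2]; ring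
    · rw [map_sub, hz, e1, e0, sub_self]
  rw [zero_add, one_mul] at d0
  have hrel : IsRelPrime (X 0 : PolyRing (n + 1)) (C 2 + C β * X 0) := by
    intro d h1 h2
    have h3 : d ∣ C 2 := (dvd_add_left (h1.mul_left _)).1 h2
    have h4 : FreeOf 0 d := (FreeOf.const 0 2).of_dvd (C_ne_zero.2 two_ne_zero) h3
    have h5 := h4.dvd_coeff h1 1
    rw [sepVar_X_self, Polynomial.coeff_X_one] at h5
    exact isUnit_of_dvd_one h5
  have := hrel.mul_dvd d0 d1
  have h2 : tt (n + 1) = X 0 * (C 2 + C β * X 0) := by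
    rw [tt, oplus, show (C 2 : PolyRing (n + 1)) = 1 + 1 by rw [one_add_one_eq_two]; rfl]
    ring
  rwa [h2]

theorem GQpoly_mem [NeZero n] (l : StrictPartition n) : GQpoly l ∈ GGammaPlus n := by
  obtain ⟨m, rfl⟩ := Nat.exists_eq_succ_of_ne_zero (NeZero.ne n)
  exact ⟨⟨GQpoly_isSymmetric l, fun i j h => cancelSubst_GQpoly_mem h.ne l⟩, tt_dvd_GQpoly l⟩

end Cancellation

/-! ### Partitions of length n and Grothendieck polynomials -/

section FullLength

variable {n : ℕ}

/-- The polynomial `xᵢ ⊕ xⱼ` of an unordered pair. -/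
def symPairSum (z : Sym2 (Fin n)) : PolyRing n := Sym2.lift ⟨pairSum, pairSum_comm⟩ z

theorem symPairSum_mk (i j : Fin n) : symPairSum s(i, j) = pairSum i j := rfl

/-- `∏_{i ≤ j} (xᵢ ⊕ xⱼ)`, as a product over unordered pairs. -/
def pairProd (n : ℕ) : PolyRing n :=
  ∏ z : Sym2 (Fin n), symPairSum z

theorem pairProd_ne_zero (n : ℕ) : pairProd n ≠ 0 := by
  refine prod_ne_zero_iff.2 fun z _ => ?_
  induction z with
  | _ i j => exact pairSum_ne_zero i j

theorem rename_pairProd (w : Equiv.Perm (Fin n)) : rename w (pairProd n) = pairProd n := by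
  have hbij : Function.Bijective (Sym2.map w) :=
    (Finite.injective_iff_bijective).1 (Sym2.map.injective w.injective)
  rw [pairProd, map_prod, ← hbij.prod_comp symPairSum]
  refine prod_congr rfl fun z _ => ?_
  induction z with
  | _ i j => rw [Sym2.map_mk, symPairSum_mk, symPairSum_mk, rename_pairSum]

theorem pairProd_dvd {F : PolyRing n} (h : ∀ i j, pairSum i j ∣ F) : pairProd n ∣ F := by
  refine Fintype.prod_dvd_of_isRelPrime ?_ fun z => ?_
  · intro z z' hne
    induction z with
    | _ i j =>
      induction z' with
      | _ k l => exact isRelPrime_pairSum hne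
  · induction z with
    | _ i j => exact h i j

theorem pairProd_eq : pairProd n =
    (∏ i : Fin n, pairSum i i) * ∏ i : Fin n, ∏ j ∈ Ioi i, pairSum i j := by
  have h1 : pairProd n = ∏ p : {p : Fin n × Fin n // p.1 ≤ p.2}, pairSum p.1.1 p.1.2 :=
    (Equiv.prod_comp Sym2.sortEquiv.symm _).symm
  rw [h1, ← prod_mul_distrib, ← Finset.prod_subtype (univ.filter fun p : Fin n × Fin n => p.1 ≤ p.2)
    (by simp) (fun p => pairSum p.1 p.2), prod_filter, ← univ_product_univ, prod_product]
  refine prod_congr rfl fun i _ => ?_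
  have h2 : univ.filter (fun j => i ≤ j) = insert i (Ioi i) := by
    ext j; simp [le_iff_eq_or_lt]
  rw [← prod_filter, h2, prod_insert (by simp)]

/-- The exponents `λᵢ - 1`. -/
def exponents (l : StrictPartition n) : Fin n →₀ ℕ :=
  Finsupp.equivFunOnFinite.symm fun i => l.parts.getD i 0 - 1

theorem exponents_cast (l : StrictPartition n) (a : Fin l.length) :
    exponents l (Fin.castLE l.length_le a) = l.part a - 1 := by
  simp only [exponents, StrictPartition.part, Finsupp.equivFunOnFinite_symm_apply_apply,
    Fin.val_castLE, List.getD_eq_getElem _ _ a.2]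
  rfl

/-- In full length the default value 0 is never used, and subtracting 1 from a part is not
truncated. -/
theorem parts_getD_pos (l : StrictPartition n) (hl : l.length = n) (i : Fin n) :
    0 < l.parts.getD i 0 := by
  have h : (i : ℕ) < l.parts.length := by rw [show l.parts.length = n from hl]; exact i.2
  rw [List.getD_eq_getElem _ _ h]
  exact l.pos _ (List.getElem_mem h)

theorem exponents_strictAnti (l : StrictPartition n) (hl : l.length = n) :
    StrictAnti (exponents l) := by
  intro i j hij
  have hi : (i : ℕ) < l.parts.length := by rw [show l.parts.length = n from hl]; exact i.2
  have hj : (j : ℕ) < l.parts.length := by rw [show l.parts.length = n from hl]; exact j.2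
  have h1 := List.pairwise_iff_getElem.1 l.decreasing i j hi hj hij
  have h2 := parts_getD_pos l hl j
  simp only [exponents, Finsupp.equivFunOnFinite_symm_apply_apply, List.getD_eq_getElem _ _ hi,
    List.getD_eq_getElem _ _ hj] at *
  omega

theorem StrictPartition.ext_parts {l l' : StrictPartition n} (h : l.parts = l'.parts) : l = l' := by
  cases l; cases l'; simpa using h

theorem exponents_injective {l l' : StrictPartition n} (hl : l.length = n) (hl' : l'.length = n)
    (h : exponents l = exponents l') : l = l' := by
  refine StrictPartition.ext_parts (List.ext_getElem (hl.trans hl'.symm) fun k hk hk' => ?_)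
  have hkn : k < n := lt_of_lt_of_eq hk hl
  have h1 := DFunLike.congr_fun h ⟨k, hkn⟩
  have h2 := parts_getD_pos l hl ⟨k, hkn⟩
  have h3 := parts_getD_pos l' hl' ⟨k, hkn⟩
  simp only [exponents, Finsupp.equivFunOnFinite_symm_apply_apply, List.getD_eq_getElem _ _ hk,
    List.getD_eq_getElem _ _ hk'] at *
  omega

theorem exists_exponents_eq {ν : Fin n →₀ ℕ} (hν : StrictAnti ν) :
    ∃ l : StrictPartition n, l.length = n ∧ exponents l = ν := by
  refine ⟨⟨List.ofFn fun i => ν i + 1, ?_, ?_, ?_⟩, ?_, ?_⟩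
  · rw [List.pairwise_ofFn]
    exact fun i j hij => by simpa using hν hij
  · intro a ha
    rw [List.mem_ofFn] at ha
    obtain ⟨i, rfl⟩ := ha
    exact Nat.succ_pos _
  · simp
  · simp [StrictPartition.length]
  · ext i
    simp [exponents]

theorem prod_Ioi_snd (f : Fin n → PolyRing n) :
    ∏ i : Fin n, ∏ j ∈ Ioi i, f j = ∏ j : Fin n, f j ^ (j : ℕ) := by
  rw [Finset.prod_comm' (t' := univ) (s' := fun j => Iio j) (by simp)]
  simp

/-- The sign `(-1)^{n(n-1)/2}`. -/
def pairSign (n : ℕ) : Coeff := ∏ i : Fin n, ∏ _j ∈ Ioi i, (-1)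

theorem pairSign_mul_self (n : ℕ) : pairSign n * pairSign n = 1 := by
  simp only [pairSign, ← prod_mul_distrib, neg_mul_neg, one_mul, prod_const_one]

/-- For r = n no factor x_j - x_i is left: the x_i ⊕ x_j collect into the symmetric `pairProd`, and
1 + βx_j occurs once for each i < j. -/
theorem numPoly_eq (l : StrictPartition n) (hl : l.length = n) :
    numPoly l = pairSign n • (pairProd n * grothMonomial (exponents l)) := by
  have h1 : ∏ i : Fin l.length, dpow (C β) (fun _ => (0 : PolyRing n))
      (X (Fin.castLE l.length_le i)) (l.part i) =
      (∏ i : Fin n, pairSum i i) * monomial (exponents l) 1 := by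
    rw [monomial_eq, C_1, one_mul, Finsupp.prod_fintype _ _ (by simp), ← prod_mul_distrib]
    have h2 := prod_castLE l.length_le
      (fun i => pairSum i i * X i ^ exponents l i : Fin n → PolyRing n)
    rw [prod_congr rfl (g := fun i => pairSum i i * X i ^ exponents l i)
      (fun i _ => if_pos (by rw [hl]; exact i.2))] at h2
    rw [← h2]
    refine prod_congr rfl fun a _ => ?_
    rw [exponents_cast, dpow]
    simp [pairSum, oplus]
  have h3 : ∏ i : Fin n, ∏ j ∈ Ioi i, (if (i : ℕ) < l.length then
      -(oplus (C β) (X i) (X j) * (1 + C β * X j)) else X j - X i : PolyRing n) =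
      C (pairSign n) * ((∏ i : Fin n, ∏ j ∈ Ioi i, pairSum i j) *
        ∏ i : Fin n, (1 + C β * X i) ^ (i : ℕ)) := by
    rw [← prod_Ioi_snd, pairSign, map_prod, ← prod_mul_distrib, ← prod_mul_distrib]
    refine prod_congr rfl fun i _ => ?_
    rw [map_prod, ← prod_mul_distrib, ← prod_mul_distrib]
    refine prod_congr rfl fun j _ => ?_
    rw [if_pos (by rw [hl]; exact i.2), pairSum, map_neg, C_1]
    ring
  rw [numPoly, GQnum, h1, h3, pairProd_eq, grothMonomial, smul_eq_C_mul]
  ring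

theorem antisymmetrize_smul_mul {T : PolyRing n} (hT : T.IsSymmetric) (c : Coeff)
    (f : PolyRing n) : antisymmetrize (c • (T * f)) = c • (T * antisymmetrize f) := by
  simp only [antisymmetrize, map_smul, map_mul, mul_sum, smul_sum]
  refine sum_congr rfl fun w _ => ?_
  rw [hT w, smul_comm, mul_smul_comm]

/-- A `GQ`-polynomial of full length is the product of all `xᵢ ⊕ xⱼ` with a Grothendieck
polynomial. -/
theorem vdm_mul_GQpoly (l : StrictPartition n) (hl : l.length = n) :
    vdm n * GQpoly l = pairSign n • (pairProd n * grothAlternant (exponents l)) := by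
  have h := antisymmetrize_numPoly l
  rw [hl, Nat.sub_self, Nat.factorial_zero, Nat.cast_one, one_mul, numPoly_eq l hl,
    antisymmetrize_smul_mul rename_pairProd] at h
  exact h.symm

theorem linearIndependent_GQpoly_full :
    LinearIndependent Coeff (fun l : {l : StrictPartition n // l.length = n} => GQpoly l.1) := by
  have h1 : LinearIndependent Coeff
      (fun l : {l : StrictPartition n // l.length = n} => grothAlternant (exponents l.1)) :=
    linearIndependent_grothAlternant.comp
      (fun l : {l : StrictPartition n // l.length = n} =>
        (⟨exponents l.1, exponents_strictAnti l.1 l.2⟩ : {ν : Fin n →₀ ℕ // StrictAnti ν}))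
      fun l l' h => Subtype.ext (exponents_injective l.2 l'.2 (congrArg Subtype.val h))
  have hs : pairSign n ≠ 0 := left_ne_zero_of_mul_eq_one (pairSign_mul_self n)
  have h2 := h1.map' (LinearMap.mulLeft Coeff (C (pairSign n) * pairProd n))
    (LinearMap.ker_eq_bot.2 (mul_right_injective₀
      (mul_ne_zero (C_ne_zero.2 hs) (pairProd_ne_zero n))))
  refine LinearIndependent.of_comp (LinearMap.mulLeft Coeff (vdm n)) ?_
  convert! h2 using 1
  ext1 l
  simp only [Function.comp_apply, LinearMap.mulLeft_apply]
  rw [vdm_mul_GQpoly l.1 l.2, smul_eq_C_mul, mul_assoc]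

/-- After dividing by `pairProd`, the quotient times the Vandermonde determinant is alternating,
hence a combination of alternants. Multiplying back turns each alternant into ± Vandermonde times a
GQ of length n. -/
theorem mem_span_of_pairSum_dvd {F : PolyRing n} (hF : F.IsSymmetric)
    (h : ∀ i j, pairSum i j ∣ F) :
    F ∈ Submodule.span Coeff (GQpoly '' {l : StrictPartition n | l.length = n}) := by
  obtain ⟨G, rfl⟩ := pairProd_dvd h
  have hG : G.IsSymmetric := fun w => by
    have := hF w
    rw [map_mul, rename_pairProd] at this
    exact mul_left_cancel₀ (pairProd_ne_zero n) this
  have hV : IsAlternating (vdm n * G) := fun w => by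
    rw [map_mul, hG w, rename_vdm, smul_mul_assoc]
  have h1 := Submodule.mem_map_of_mem (f := LinearMap.mulLeft Coeff (pairProd n)) hV.mem_span
  rw [Submodule.map_span] at h1
  have h2 : Submodule.span Coeff (LinearMap.mulLeft Coeff (pairProd n) ''
      (grothAlternant '' {ν : Fin n →₀ ℕ | StrictAnti ν})) ≤
      (Submodule.span Coeff (GQpoly '' {l : StrictPartition n | l.length = n})).map
        (LinearMap.mulLeft Coeff (vdm n)) := by
    rw [Submodule.span_le]
    rintro _ ⟨_, ⟨ν, hν, rfl⟩, rfl⟩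
    obtain ⟨l, hl, rfl⟩ := exists_exponents_eq hν
    refine ⟨pairSign n • GQpoly l, Submodule.smul_mem _ _ (Submodule.subset_span ⟨l, hl, rfl⟩), ?_⟩
    rw [map_smul, LinearMap.mulLeft_apply, vdm_mul_GQpoly l hl, smul_smul, pairSign_mul_self,
      one_smul, LinearMap.mulLeft_apply]
  obtain ⟨Q, hQ, e⟩ := h2 h1
  rw [LinearMap.mulLeft_apply, LinearMap.mulLeft_apply, mul_left_comm] at e
  rwa [← mul_left_cancel₀ (vdm_ne_zero n) e]

end FullLength

/-! ### Induction on n through x₁ = 0 -/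

section Restriction

variable {n : ℕ}

/-- The specialization `x₁ = 0`, followed by a shift of the indices. -/
def restrictVars (n : ℕ) : PolyRing (n + 1) →ₐ[Coeff] PolyRing n :=
  aeval (Fin.cons 0 X : Fin (n + 1) → PolyRing n)

@[simp] theorem restrictVars_X_zero : restrictVars n (X 0) = 0 := by simp [restrictVars]

@[simp] theorem restrictVars_X_succ (k : Fin n) : restrictVars n (X k.succ) = X k := by
  simp [restrictVars]

theorem restrictVars_mem {F : PolyRing (n + 1)} (hF : F ∈ divisibilityModule (n + 1)) :
    restrictVars n F ∈ divisibilityModule n := by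
  refine ⟨fun w => ?_, fun i j => ?_⟩
  · have h : (rename w : PolyRing n →ₐ[Coeff] PolyRing n).comp (restrictVars n) =
        -- This permutation fixes the index 0 and acts as w on the successors.
        (restrictVars n).comp (rename (Equiv.Perm.decomposeFin.symm (0, w))) := by
      ext1 k
      refine Fin.cases ?_ (fun k => ?_) k <;> simp
    have h1 := DFunLike.congr_fun h F
    simp only [AlgHom.comp_apply] at h1
    rw [h1, hF.1]
  · have h : (restrictVars n).comp (zeroPair i.succ j.succ) =
        (zeroPair i j).comp (restrictVars n) := by
      ext1 k
      refine Fin.cases ?_ (fun k => ?_) k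
      · simp [zeroPair, apply_ite]
      · by_cases h : k = i ∨ k = j <;> simp [zeroPair, h]
    have h1 := DFunLike.congr_fun h F
    simp only [AlgHom.comp_apply] at h1
    have h2 := map_dvd (restrictVars n) (hF.2 i.succ j.succ)
    rw [map_sub, h1] at h2
    have h3 : restrictVars n (pairSum i.succ j.succ) = pairSum i j := by
      simp [pairSum, oplus, ← algebraMap_eq]
    rwa [h3] at h2

/-- A strict partition of length at most `n` has length at most `n + 1`. -/
def StrictPartition.lift (l : StrictPartition n) : StrictPartition (n + 1) :=
  ⟨l.parts, l.decreasing, l.pos, l.length_parts_le.trans (Nat.le_succ n)⟩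

theorem algebraMap_restrictVars_GQpoly (l : StrictPartition (n + 1)) :
    algebraMap (PolyRing n) (RatField n) (restrictVars n (GQpoly l)) =
      embSum (algebraMap (PolyRing n) (RatField n) (C β)) l.part
        (fun i => algebraMap (PolyRing n) (RatField n) (X i)) := by
  have h := map_GQpoly_of_two_torsion
    ((algebraMap (PolyRing n) (RatField n)).comp (restrictVars n).toRingHom) ?_ ?_ l
  · simpa [← algebraMap_eq] using h
  · intro i k
    refine Fin.cases ?_ (fun i => ?_) i <;> refine Fin.cases ?_ (fun k => ?_) k
    · simp
    · intro h
      simp only [RingHom.comp_apply, AlgHom.toRingHom_eq_coe, RingHom.coe_coe,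
        restrictVars_X_zero, restrictVars_X_succ, map_zero] at h
      exact absurd ((map_eq_zero_iff _ polyRing_algebraMap_injective).1 h.symm) (X_ne_zero k)
    · simp
    · simp
  · simp [oplus]

theorem algebraMap_GQpoly_eq_embSum (l : StrictPartition n) :
    algebraMap (PolyRing n) (RatField n) (GQpoly l) =
      embSum (algebraMap (PolyRing n) (RatField n) (C β)) l.part
        (fun i => algebraMap (PolyRing n) (RatField n) (X i)) :=
  map_GQpoly _ algebraMap_X_injective l

theorem restrictVars_GQpoly_lift (l : StrictPartition n) :
    restrictVars n (GQpoly l.lift) = GQpoly l := by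
  apply polyRing_algebraMap_injective
  rw [algebraMap_restrictVars_GQpoly, algebraMap_GQpoly_eq_embSum]
  rfl

/-- The restriction is a sum over injections of n + 1 indices into n, which is empty. -/
theorem restrictVars_GQpoly_of_length (l : StrictPartition (n + 1)) (hl : l.length = n + 1) :
    restrictVars n (GQpoly l) = 0 := by
  apply polyRing_algebraMap_injective
  rw [algebraMap_restrictVars_GQpoly, map_zero, embSum]
  have : IsEmpty (Fin l.length ↪ Fin n) := ⟨fun e => by
    have := Fintype.card_le_of_embedding e
    simp [hl] at this⟩
  exact Fintype.sum_empty _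

/-- By symmetry F vanishes on every x_i = 0, so the subtracted term F|_{x_i = x_j = 0} is zero and
x_i ⊕ x_j divides F itself. -/
theorem mem_span_of_restrictVars_eq_zero {F : PolyRing (n + 1)}
    (hF : F ∈ divisibilityModule (n + 1)) (h0 : restrictVars n F = 0) :
    F ∈ Submodule.span Coeff (GQpoly '' {l : StrictPartition (n + 1) | l.length = n + 1}) := by
  refine mem_span_of_pairSum_dvd hF.1 fun i j => ?_
  have h1 : zeroPair 0 0 F = 0 := by
    have h : (rename Fin.succ : PolyRing n →ₐ[Coeff] _).comp (restrictVars n) =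
        zeroPair 0 0 := by
      ext1 k
      refine Fin.cases ?_ (fun k => ?_) k <;> simp [zeroPair]
    rw [← h, AlgHom.comp_apply, h0, map_zero]
  have h2 : zeroPair i i F = 0 := by
    have := rename_zeroPair (Equiv.swap 0 i) 0 0 F
    rw [h1, map_zero, hF.1, Equiv.swap_apply_left] at this
    exact this.symm
  have h3 : zeroPair i j F = 0 := by
    have h : (zeroPair i j).comp (zeroPair i i) = zeroPair i j := by
      ext1 k
      by_cases hk : k = i <;> simp [zeroPair, hk]
    rw [← h, AlgHom.comp_apply, h2, map_zero]
  have := hF.2 i j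
  rwa [h3, sub_zero] at this

theorem lift_or_full_bijective : Function.Bijective
    (Sum.elim StrictPartition.lift Subtype.val :
      StrictPartition n ⊕ {l : StrictPartition (n + 1) // l.length = n + 1} →
        StrictPartition (n + 1)) := by
  constructor
  · rintro (l | l) (l' | l') h
    · congr 1
      have h1 := congrArg StrictPartition.parts h
      exact StrictPartition.ext_parts h1
    · exfalso
      have h1 := congrArg StrictPartition.length h
      have h2 := l.length_le
      have h3 : l.lift.length = l.length := rfl
      simp only [Sum.elim_inl, Sum.elim_inr, l'.2] at h1
      omega
    · exfalso
      have h1 := congrArg StrictPartition.length h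
      have h2 := l'.length_le
      have h3 : l'.lift.length = l'.length := rfl
      simp only [Sum.elim_inl, Sum.elim_inr, l.2] at h1
      omega
    · congr 1
      exact Subtype.ext h
  · intro l
    by_cases hl : l.length = n + 1
    · exact ⟨Sum.inr ⟨l, hl⟩, rfl⟩
    · refine ⟨Sum.inl ⟨l.parts, l.decreasing, l.pos, ?_⟩, rfl⟩
      have h1 := l.length_le
      change l.length ≤ n
      omega

/-- The lifted functions stay independent after restriction, so their span meets the kernel
trivially, and the functions of length n + 1 lie in that kernel. -/
theorem linearIndependent_GQpoly (n : ℕ) :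
    LinearIndependent Coeff (GQpoly : StrictPartition n → PolyRing n) := by
  induction n with
  | zero =>
    have h1 : ∀ l : StrictPartition 0, l.length = 0 := fun l => Nat.le_zero.1 l.length_le
    exact (linearIndependent_GQpoly_full (n := 0)).comp (fun l => ⟨l, h1 l⟩)
      fun l l' h => congrArg Subtype.val h
  | succ n ih =>
    have hcomp : (restrictVars n).toLinearMap ∘ (fun l : StrictPartition n => GQpoly l.lift) =
        GQpoly := funext restrictVars_GQpoly_lift
    have h1 : LinearIndependent Coeff (fun l : StrictPartition n => GQpoly l.lift) :=
      LinearIndependent.of_comp (restrictVars n).toLinearMap (by rw [hcomp]; exact ih)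
    have h2 := Submodule.range_ker_disjoint (R := Coeff) (f := (restrictVars n).toLinearMap)
      (v := fun l : StrictPartition n => GQpoly l.lift) (by rw [hcomp]; exact ih)
    have h3 := h1.sum_type (linearIndependent_GQpoly_full (n := n + 1)) (h2.mono_right (by
      rw [Submodule.span_le]
      rintro _ ⟨l, rfl⟩
      exact restrictVars_GQpoly_of_length l.1 l.2))
    have h4 := (linearIndependent_equiv (R := Coeff) (Equiv.ofBijective _ lift_or_full_bijective)
      (f := (GQpoly : StrictPartition (n + 1) → PolyRing (n + 1)))).1
    refine h4 ?_
    convert! h3 using 1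
    ext1 l
    cases l <;> rfl

/-- The restriction of F is a combination of GQ's, which lifts to n + 1 variables; the lift lies in
the same module, so its difference from F is a kernel element of that module. -/
theorem divisibilityModule_le_span (n : ℕ) : divisibilityModule n ≤
    Submodule.span Coeff (Set.range (GQpoly : StrictPartition n → PolyRing n)) := by
  induction n with
  | zero =>
    intro F hF
    exact Submodule.span_mono (Set.image_subset_range _ _)
      (mem_span_of_pairSum_dvd hF.1 fun i => i.elim0)
  | succ n ih =>
    intro F hF
    have h1 : Submodule.span Coeff (Set.range (GQpoly : StrictPartition n → PolyRing n)) ≤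
        (Submodule.span Coeff (Set.range (GQpoly : StrictPartition (n + 1) → _))).map
          (restrictVars n).toLinearMap := by
      rw [Submodule.span_le]
      rintro _ ⟨l, rfl⟩
      exact ⟨GQpoly l.lift, Submodule.subset_span ⟨_, rfl⟩, restrictVars_GQpoly_lift l⟩
    obtain ⟨G, hG, e⟩ := h1 (ih (restrictVars_mem hF))
    have hG' : G ∈ divisibilityModule (n + 1) := by
      refine Submodule.span_le.2 ?_ hG
      rintro _ ⟨l, rfl⟩
      exact mem_divisibilityModule (GQpoly_mem l)
    have h2 := mem_span_of_restrictVars_eq_zero (sub_mem hF hG')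
      (by rw [map_sub, sub_eq_zero]; exact e.symm)
    have h3 := Submodule.span_mono (Set.image_subset_range _ _) h2
    simpa using add_mem h3 hG

end Restriction

end KTheoreticQ

end

theorem mainTheorem4 (n : ℕ) [NeZero n] :
    ∃ B : Module.Basis (KTheoreticQ.StrictPartition n) KTheoreticQ.Coeff (KTheoreticQ.GGammaPlus n),
      ∀ l : KTheoreticQ.StrictPartition n,
        algebraMap (KTheoreticQ.PolyRing n) (KTheoreticQ.RatField n) (B l : KTheoreticQ.PolyRing n) =
          KTheoreticQ.GQ l := by
  let v : KTheoreticQ.StrictPartition n → KTheoreticQ.GGammaPlus n := fun l =>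
    ⟨KTheoreticQ.GQpoly l, KTheoreticQ.GQpoly_mem l⟩
  let ι : KTheoreticQ.GGammaPlus n →ₗ[KTheoreticQ.Coeff] KTheoreticQ.PolyRing n :=
    (KTheoreticQ.GGammaPlus n).val.toLinearMap
  have hv : ι ∘ v = KTheoreticQ.GQpoly := rfl
  have hli : LinearIndependent KTheoreticQ.Coeff v :=
    LinearIndependent.of_comp ι (by rw [hv]; exact KTheoreticQ.linearIndependent_GQpoly n)
  have hsp : ⊤ ≤ Submodule.span KTheoreticQ.Coeff (Set.range v) := by
    rintro ⟨F, hF⟩ -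
    have h1 := KTheoreticQ.divisibilityModule_le_span n (KTheoreticQ.mem_divisibilityModule hF)
    rw [← hv, Set.range_comp, ← Submodule.map_span] at h1
    obtain ⟨G, hG, e⟩ := h1
    have : G = ⟨F, hF⟩ := Subtype.ext e
    rwa [← this]
  refine ⟨Module.Basis.mk hli hsp, fun l => ?_⟩
  rw [Module.Basis.mk_apply]
  exact KTheoreticQ.algebraMap_GQpoly l
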